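/- Theorem (Regret of LR-COMB). Consider $N\ge 1$ users, $M\ge 1$ items and $T\ge 1$ rounds. In round $t$ the valid allocations are $\mathcal X_t=\{X\in\{0,1\}^{N\times M}: X\mathbf 1\le d_t,\ X^{\mathsf T}\mathbf 1\le c_t\}$ for known demands $d_t\in\mathbb R^N$ and capacities $c_t\in\mathbb R^M$. All rewards $R_{t,u,i}$ are independent and $\eta$-sub-Gaussian with mean $\theta^*_{ui}$. The learner plays $X_t\in\mathcal X_t$ on the basis of the previously observed rewards, and then observes $R_{t,u,i}$ for the pairs $(u,i)\in\mathcal A_t=\{(u,i):(X_t)_{ui}=1\}$. The mean matrix $\Theta^*$ lies in $$\mathcal L=\{\Theta\in\mathbb R^{N\times M}:\operatorname{rank}\Theta\le R,\ \theta_{ui}\in[0,B]\ \forall u,i\},$$ and an initial estimate $\overline\Theta$ with $\|\overline\Theta-\Theta^*\|_F\le G$ is given. For parameters $\delta,\alpha>0$ and $\gamma\ge1$, the algorithm does the following in each round $t=1,\dots,T$. It takes a minimizer $\widehat\Theta_t$ over $\Theta\in\mathcal L$ of $\sum_{\tau<t}\sum_{(u,i)\in\mathcal A_\tau}(\theta_{ui}-R_{\tau,u,i})^2+\gamma\|\Theta-\overline\Theta\|_F^2$.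 It forms the confidence set $$\mathcal C_t=\Big\{\Theta\in\mathcal L:\sum_{u,i}(n_{t,u,i}+\gamma)(\Theta-\widehat\Theta_t)_{ui}^2\le\beta_t^*\Big\},$$ where $n_{t,u,i}$ is the number of rounds $\tau<t$ with $(u,i)\in\mathcal A_\tau$, and $$\beta_t^*=8\eta^2\log\frac{\mathcal N(\mathcal L,\alpha,\|\cdot\|_F)}{\delta}+2\alpha tNM\Big[8B+\sqrt{8\eta^2\log(4NMt^2/\delta)}\Big]+4\gamma G^2,$$ with $\mathcal N(\mathcal L,\alpha,\|\cdot\|_F)$ the $\alpha$-covering number of $\mathcal L$ in the Frobenius norm. It then plays some $X_t\in\arg\max_{X\in\mathcal X_t}\max_{\Theta\in\mathcal C_t}\langle X,\Theta\rangle$. Let $\mathcal R(T)=\sum_{t=1}^T\big[\langle X_t^*,\Theta^*\rangle-\langle X_t,\Theta^*\rangle\big]$, where $X_t^*\in\arg\max_{X\in\mathcal X_t}\langle X,\Theta^*\rangle$. Then, with the choice $\delta=\alpha=1/(NMT)$ and $\gamma=1$, the algorithm has cumulative regret $\widetilde{\mathcal O}\big(\sqrt{NM(N+M)RT}\big)$,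 both with high probability and in expectation. That is, there are an absolute exponent $k$ and a constant $C$ depending only on $\eta,B,G$ such that, for all $N,M,R,T$ and all instances as above, the bound $$\mathcal R(T)\le C\,\log^k(1+NMT)\,\sqrt{NM(N+M)RT}$$ holds with probability at least $1-\frac{2}{NMT}$, and $\mathbb E[\mathcal R(T)]$ is bounded by the same quantity. -/

import Mathlib

open scoped NNReal Matrix
open MeasureTheory ProbabilityTheory

-- Norms of matrices are Frobenius norms throughout.
attribute [local instance] Matrix.frobeniusNormedAddCommGroup

namespace LRComb

/-- Real `N × M` matrices: rows are users, columns are items. -/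
abbrev Mat (N M : ℕ) : Type := Matrix (Fin N) (Fin M) ℝ

/-- The product (Borel) sigma-algebra on matrices. -/
instance instMeasurableSpaceMat (N M : ℕ) : MeasurableSpace (Mat N M) :=
  inferInstanceAs (MeasurableSpace (Fin N → Fin M → ℝ))

/-- The Frobenius inner product `⟨A, B⟩ = tr (Aᵀ B)`. -/
noncomputable def frobInner {N M : ℕ} (A B : Mat N M) : ℝ := (Aᵀ * B).trace

/-- The valid allocation matrices for user demands `d` and item capacities `c`:
zero-one matrices `X` with `X 1 ≤ d` and `Xᵀ 1 ≤ c` entrywise. -/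
def validAllocations {N M : ℕ} (d : Fin N → ℝ) (c : Fin M → ℝ) : Set (Mat N M) :=
  {X | (∀ u i, X u i = 0 ∨ X u i = 1) ∧ X *ᵥ 1 ≤ d ∧ Xᵀ *ᵥ 1 ≤ c}

/-- The set of user-item pairs that an allocation matrix plays. -/
noncomputable def arms {N M : ℕ} (X : Mat N M) : Finset (Fin N × Fin M) :=
  Finset.univ.filter fun p => X p.1 p.2 = 1

/-- The rewards that are revealed when `X` is played and the rewards are `r`: the entries of `r`
at the played pairs (the other entries are masked by zero). -/
noncomputable def observed {N M : ℕ} (X r : Mat N M) : Mat N M :=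
  Matrix.of fun u i => if (u, i) ∈ arms X then r u i else 0

/-- A history of `s` completed rounds: for each of them, the allocation matrix that was played
and the observed rewards. -/
abbrev History (N M s : ℕ) : Type := Fin s → Mat N M × Mat N M

/-- A (deterministic) policy: `π s` chooses the allocation of round `s + 1` from the history of
the `s` rounds before it. -/
abbrev Policy (N M : ℕ) : Type := (s : ℕ) → History N M s → Mat N M

/-- The history of the first `s` rounds when the policy `π` is run; `r s` holds the rewards of
round `s + 1`. -/
noncomputable def playedHistory {N M : ℕ} (π : Policy N M) (r : ℕ → Mat N M) :
    (s : ℕ) → History N M s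
  | 0 => Fin.elim0
  | s + 1 =>
    let h := playedHistory π r s
    Fin.snoc (α := fun _ => Mat N M × Mat N M) h (π s h, observed (π s h) (r s))

/-- The allocation matrix that `π` plays in round `s + 1`. -/
noncomputable def played {N M : ℕ} (π : Policy N M) (r : ℕ → Mat N M) (s : ℕ) : Mat N M :=
  π s (playedHistory π r s)

/-- The cumulative squared prediction error of `Θ` on a history. -/
noncomputable def squaredError {N M s : ℕ} (h : History N M s) (Θ : Mat N M) : ℝ :=
  ∑ τ, ∑ p ∈ arms (h τ).1, (Θ p.1 p.2 - (h τ).2 p.1 p.2) ^ 2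

/-- The number of times that item `i` was allocated to user `u` in a history. -/
noncomputable def count {N M s : ℕ} (h : History N M s) (u : Fin N) (i : Fin M) : ℕ :=
  (Finset.univ.filter fun τ => (u, i) ∈ arms (h τ).1).card

/-- The regularized empirical 2-norm `(∑ (n_{u,i} + γ) Δ_{u,i}²)^{1/2}` after a history. -/
noncomputable def empNorm {N M s : ℕ} (γ : ℝ) (h : History N M s) (Δ : Mat N M) : ℝ :=
  √(∑ u, ∑ i, ((count h u i : ℝ) + γ) * Δ u i ^ 2)

/-- The `α`-covering number of a set of matrices in the Frobenius norm
(least number of points of `L` whose closed `α`-balls cover `L`). -/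
noncomputable def covNum {N M : ℕ} (L : Set (Mat N M)) (α : ℝ) : ℕ :=
  (Metric.coveringNumber α.toNNReal L).toNat

/-- The confidence parameter `β_t*(δ, α, γ)` of round `t` (rounds are numbered from 1). -/
noncomputable def betaStar {N M : ℕ} (L : Set (Mat N M)) (η B G δ α γ : ℝ) (t : ℕ) : ℝ :=
  8 * η ^ 2 * Real.log (covNum L α / δ)
    + 2 * α * t * (N * M) * (8 * B + √(8 * η ^ 2 * Real.log (4 * (N * M) * (t : ℝ) ^ 2 / δ)))
    + 4 * γ * G ^ 2

/-- `Θhat` is a regularized least squares estimate over `L` for the history `h`. -/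
def IsLeastSquares {N M s : ℕ} (L : Set (Mat N M)) (Θbar : Mat N M) (γ : ℝ)
    (h : History N M s) (Θhat : Mat N M) : Prop :=
  Θhat ∈ L ∧ ∀ Θ ∈ L,
    squaredError h Θhat + γ * ‖Θhat - Θbar‖ ^ 2 ≤ squaredError h Θ + γ * ‖Θ - Θbar‖ ^ 2

/-- The confidence set around `Θhat` with squared radius `β`. -/
def confidenceSet {N M s : ℕ} (L : Set (Mat N M)) (γ β : ℝ) (h : History N M s)
    (Θhat : Mat N M) : Set (Mat N M) :=
  {Θ | Θ ∈ L ∧ empNorm γ h (Θ - Θhat) ≤ √β}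

/-- `X ∈ argmax_{X ∈ 𝒳} max_{Θ ∈ C} ⟨X, Θ⟩`, the inner maximum for `X` being attained. -/
def IsOptimistic {N M : ℕ} (𝒳 C : Set (Mat N M)) (X : Mat N M) : Prop :=
  X ∈ 𝒳 ∧ ∃ Θ ∈ C, ∀ X' ∈ 𝒳, ∀ Θ' ∈ C, frobInner X' Θ' ≤ frobInner X Θ

/-- `π` is an implementation, with horizon `T`, of the optimistic algorithm for structured
combinatorial bandits: in each round `s + 1 ≤ T` it forms a regularized least squares estimate,
takes the confidence set around it, and plays an allocation that is optimistic for this set.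
Ties in the minimization and the maximization may be broken in any way. -/
def FollowsAlgorithm {N M : ℕ} (T : ℕ) (𝒳 : ℕ → Set (Mat N M)) (L : Set (Mat N M))
    (Θbar : Mat N M) (η B G δ α γ : ℝ) (π : Policy N M) : Prop :=
  ∀ s < T, ∀ h : History N M s, ∃ Θhat, IsLeastSquares L Θbar γ h Θhat ∧
    IsOptimistic (𝒳 s) (confidenceSet L γ (betaStar L η B G δ α γ (s + 1)) h Θhat) (π s h)

/-- The matrices of rank at most `R` with all entries in `[0, B]`. -/
def lowRankSet (N M R : ℕ) (B : ℝ) : Set (Mat N M) :=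
  {Θ | Θ.rank ≤ R ∧ ∀ u i, Θ u i ∈ Set.Icc 0 B}

/-- The rewards `r s ω u i` (round `s + 1`, user `u`, item `i`) are independent random variables,
each `η`-sub-Gaussian with mean `Θstar u i`. -/
structure IsRewardModel {N M : ℕ} {Ω : Type*} [MeasurableSpace Ω] (μ : Measure Ω)
    (η : ℝ≥0) (Θstar : Mat N M) (r : ℕ → Ω → Mat N M) : Prop where
  measurable : ∀ s u i, Measurable fun ω => r s ω u i
  indep : iIndepFun (fun (p : ℕ × Fin N × Fin M) (ω : Ω) => r p.1 ω p.2.1 p.2.2) μ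
  mean : ∀ s u i, ∫ ω, r s ω u i ∂μ = Θstar u i
  subGaussian : ∀ s u i, HasSubgaussianMGF (fun ω => r s ω u i - Θstar u i) (η ^ 2) μ

/-- `X` is an optimal allocation among `𝒳` for the mean reward matrix `Θ`. -/
def IsOptimalAllocation {N M : ℕ} (𝒳 : Set (Mat N M)) (Θ X : Mat N M) : Prop :=
  X ∈ 𝒳 ∧ ∀ X' ∈ 𝒳, frobInner X' Θ ≤ frobInner X Θ

/-- The cumulative regret after `T` rounds of `π` against the allocations `Xopt`. -/
noncomputable def regret {N M : ℕ} (Θstar : Mat N M) (Xopt : ℕ → Mat N M) (π : Policy N M)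
    (r : ℕ → Mat N M) (T : ℕ) : ℝ :=
  ∑ s ∈ Finset.range T, (frobInner (Xopt s) Θstar - frobInner (played π r s) Θstar)

end LRComb

/-!
The proof is the optimism argument for combinatorial bandits, with the confidence sets of a least
squares estimate over a class of small metric entropy.

*Confidence.* For a fixed matrix `Θ`, the excess squared error of `Θ` over the mean matrix is a
quadratic term minus a martingale that is linear in the noise. Predictable weights turn independent
sub-Gaussian noise into an exponential supermartingale (`lintegral_exp_logWealth_le_one`), and
Ville's inequality (`measure_exists_logWealth_ge_le`) bounds the martingale by half of the quadratic
term plus a logarithm, in all rounds at once. A union bound over a minimal `α`-cover, together with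
a uniform bound on the single noise variables, which pays for replacing the estimate by the nearest
point of the cover, gives the event `GoodNoise` of probability at least `1 - 2 δ`
(`measure_not_goodNoise_le`). On this event the mean matrix lies in every confidence set
(`sum_count_mul_sq_le_betaStar`).

*Regret.* On good noise, optimism bounds the regret of a round by the width of the confidence
ellipsoid in the direction of the played allocation, that is by `√(4 β V)`, where `V` is the sum
of `1 / (n + 1)` over the played pairs and `n` counts the earlier plays of a pair
(`round_regret_le`). By Cauchy–Schwarz over the rounds it is enough to bound the sum of the `V`s, in
which every one of the `N M` pairs contributes a harmonic sum (`sum_sum_arms_inv_count_le`). So the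
regret is at most `√(4 β T N M (1 + log T))`.

*Metric entropy.* A matrix of rank at most `R` with bounded entries is a product of two matrices
with polynomially bounded entries, `R (N + M)` in number. Rounding them to a grid shows that the
logarithm of the covering number at scale `1 / (N M T)` is at most a constant times
`R (N + M) log (1 + N M T)` (`log_covNum_lowRankSet_le`). Hence `β` has this order as well
(`betaStar_le`). The expectation follows because the regret never exceeds `N M T B` while the
exceptional event has probability at most `2 / (N M T)`.
-/

namespace LRComb

/-! ### Metric entropy of the low-rank matrices -/

/-- If points of `L` with the same code are `ε`-close, one representative per code is an
`ε`-cover of `L`. -/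
theorem coveringNumber_le_card_of_code {X ι : Type*} [PseudoEMetricSpace X] [Fintype ι]
    (L : Set X) (ε : ℝ≥0) (f : X → ι)
    (hf : ∀ x ∈ L, ∀ y ∈ L, f x = f y → edist x y ≤ ε) :
    Metric.coveringNumber ε L ≤ Fintype.card ι := by
  classical
  have hch : ∀ i : f '' L, ∃ x ∈ L, f x = i := fun i => i.2
  choose g hgL hgf using hch
  have hsub : Set.range g ⊆ L := by
    rintro _ ⟨i, rfl⟩
    exact hgL i
  have hcov : Metric.IsCover ε L (Set.range g) := by
    intro x hx
    exact ⟨g ⟨f x, x, hx, rfl⟩, ⟨_, rfl⟩, hf _ hx _ (hgL _) (hgf ⟨f x, x, hx, rfl⟩).symm⟩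
  refine (hcov.coveringNumber_le_encard hsub).trans ?_
  calc (Set.range g).encard = (g '' Set.univ).encard := by rw [Set.image_univ]
    _ ≤ (Set.univ : Set (f '' L)).encard := Set.encard_image_le _ _
    _ = (f '' L).encard := by rw [Set.encard_univ, Set.encard, ENat.card]
    _ ≤ (Set.univ : Set ι).encard := Set.encard_le_encard (Set.subset_univ _)
    _ = Fintype.card ι := by simp [Set.encard_univ]

/-- Rounding the interval `[-Q, Q]` down to a grid of width `ε`. -/
theorem exists_rounding {Q ε : ℝ} (hε : 0 < ε) :
    ∃ c : ℝ → Fin (⌊2 * Q / ε⌋₊ + 1), ∀ x y, |x| ≤ Q → |y| ≤ Q → c x = c y → |x - y| ≤ ε := by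
  refine ⟨fun x => Fin.ofNat _ ⌊(x + Q) / ε⌋₊, fun x y hx hy h => ?_⟩
  have hlt : ∀ z : ℝ, |z| ≤ Q → ⌊(z + Q) / ε⌋₊ < ⌊2 * Q / ε⌋₊ + 1 := fun z hz => by
    refine Nat.lt_succ_of_le (Nat.floor_le_floor ?_)
    have := (abs_le.1 hz).2
    gcongr
    linarith
  have h' : ⌊(x + Q) / ε⌋₊ = ⌊(y + Q) / ε⌋₊ := by
    have := congrArg Fin.val h
    simpa [Nat.mod_eq_of_lt (hlt x hx), Nat.mod_eq_of_lt (hlt y hy)] using this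
  have hnn : ∀ z : ℝ, |z| ≤ Q → 0 ≤ (z + Q) / ε := fun z hz =>
    div_nonneg (by linarith [(abs_le.1 hz).1]) hε.le
  have hx1 := Nat.floor_le (hnn x hx)
  have hx2 := Nat.lt_floor_add_one ((x + Q) / ε)
  have hy1 := Nat.floor_le (hnn y hy)
  have hy2 := Nat.lt_floor_add_one ((y + Q) / ε)
  rw [h'] at hx1 hx2
  have : |(x + Q) / ε - (y + Q) / ε| ≤ 1 := by
    rw [abs_le]; constructor <;> linarith
  have e : (x + Q) / ε - (y + Q) / ε = (x - y) / ε := by ring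
  rwa [e, abs_div, abs_of_pos hε, div_le_one hε] at this

/-- A matrix of rank at most `r` factors through `Fin r` with controlled entries: the left factor
consists of an orthonormal basis of the column space, padded by zero columns. -/
theorem exists_bounded_factorization {N M r : ℕ} {B : ℝ} (Θ : Mat N M) (hr : Θ.rank ≤ r)
    (hB : ∀ u i, |Θ u i| ≤ B) :
    ∃ (A : Matrix (Fin N) (Fin r) ℝ) (W : Matrix (Fin r) (Fin M) ℝ), Θ = A * W ∧
      (∀ u k, |A u k| ≤ 1) ∧ ∀ k i, |W k i| ≤ N * B := by
  classical
  let e := (WithLp.linearEquiv 2 ℝ (Fin N → ℝ)).symm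
  let S : Submodule ℝ (EuclideanSpace ℝ (Fin N)) := (LinearMap.range Θ.mulVecLin).map e.toLinearMap
  have hS : Module.finrank ℝ S ≤ r := by
    refine le_trans (le_of_eq ?_) hr
    exact LinearEquiv.finrank_map_eq e _
  let b := stdOrthonormalBasis ℝ S
  have hcol : ∀ i : Fin M, (WithLp.toLp 2 fun u => Θ u i) ∈ S := fun i => by
    refine ⟨fun u => Θ u i, ⟨Pi.single i 1, ?_⟩, rfl⟩
    ext u
    simp
  let v : Fin M → S := fun i => ⟨_, hcol i⟩
  have hb1 : ∀ k u, |(b k : EuclideanSpace ℝ (Fin N)) u| ≤ 1 := fun k u => by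
    have h1 := PiLp.norm_apply_le (b k : EuclideanSpace ℝ (Fin N)) u
    have h2 : ‖(b k : EuclideanSpace ℝ (Fin N))‖ = 1 := b.orthonormal.1 k
    rwa [h2, Real.norm_eq_abs] at h1
  have hinj : Function.Injective (Fin.castLE hS) := Fin.castLE_injective hS
  refine ⟨Matrix.of fun u => Function.extend (Fin.castLE hS)
      (fun k => (b k : EuclideanSpace ℝ (Fin N)) u) 0,
    Matrix.of fun k i => Function.extend (Fin.castLE hS) (fun k => inner ℝ (b k) (v i)) 0 k,
    ?_, ?_, ?_⟩
  · ext u i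
    rw [Matrix.mul_apply]
    have h1 := b.sum_repr' (v i)
    have h2 : Θ u i = ∑ k, (b k : EuclideanSpace ℝ (Fin N)) u * inner ℝ (b k) (v i) := by
      have h3 := congrArg (fun z : S => (z : EuclideanSpace ℝ (Fin N)) u) h1
      simp only [Submodule.coe_sum, Submodule.coe_smul, WithLp.ofLp_sum, Finset.sum_apply,
        PiLp.smul_apply, smul_eq_mul] at h3
      rw [show Θ u i = (v i : EuclideanSpace ℝ (Fin N)) u from rfl, ← h3]
      exact Finset.sum_congr rfl fun k _ => mul_comm _ _
    rw [h2]
    refine Fintype.sum_of_injective _ hinj _ _ (fun k hk => ?_) fun k => ?_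
    · simp [Function.extend_apply' _ _ _ hk]
    · simp [hinj.extend_apply]
  · intro u k
    by_cases hk : ∃ a, Fin.castLE hS a = k
    · obtain ⟨a, rfl⟩ := hk
      simpa [hinj.extend_apply] using hb1 a u
    · simp [Function.extend_apply' _ _ _ hk]
  · intro k i
    have hN : 0 ≤ N * B := by
      rcases Nat.eq_zero_or_pos N with rfl | h
      · simp
      · exact mul_nonneg (Nat.cast_nonneg _) ((abs_nonneg _).trans (hB ⟨0, h⟩ i))
    by_cases hk : ∃ a, Fin.castLE hS a = k
    · obtain ⟨a, rfl⟩ := hk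
      simp only [Matrix.of_apply, hinj.extend_apply]
      rw [Submodule.coe_inner, PiLp.inner_apply]
      calc |∑ u, inner ℝ ((b a : EuclideanSpace ℝ (Fin N)) u) (Θ u i)|
          ≤ ∑ u, |inner ℝ ((b a : EuclideanSpace ℝ (Fin N)) u) (Θ u i)| :=
            Finset.abs_sum_le_sum_abs _ _
        _ ≤ ∑ _u : Fin N, B := Finset.sum_le_sum fun u _ => by
            simp only [RCLike.inner_apply, conj_trivial, abs_mul]
            calc _ ≤ B * 1 := mul_le_mul (hB u i) (hb1 a u) (abs_nonneg _)
                  ((abs_nonneg _).trans (hB u i))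
              _ = B := mul_one B
        _ = N * B := by simp
    · simpa [Function.extend_apply' _ _ _ hk] using hN

theorem sq_frobenius_norm {N M : ℕ} (A : Mat N M) : ‖A‖ ^ 2 = ∑ u, ∑ i, A u i ^ 2 := by
  rw [Matrix.frobenius_norm_def, ← Real.sqrt_eq_rpow, Real.sq_sqrt (by positivity)]
  simp

theorem abs_apply_le_frobenius_norm {N M : ℕ} (A : Mat N M) (u : Fin N) (i : Fin M) :
    |A u i| ≤ ‖A‖ := by
  refine abs_le_of_sq_le_sq ?_ (norm_nonneg _)
  rw [sq_frobenius_norm]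
  calc A u i ^ 2 ≤ ∑ j, A u j ^ 2 :=
        Finset.single_le_sum (f := fun j => A u j ^ 2) (fun _ _ => sq_nonneg _)
          (Finset.mem_univ i)
    _ ≤ _ := Finset.single_le_sum (f := fun w => ∑ j, A w j ^ 2)
          (fun _ _ => Finset.sum_nonneg fun _ _ => sq_nonneg _) (Finset.mem_univ u)

theorem frobenius_norm_le_of_abs_le {N M : ℕ} (hN : 0 < N) (hM : 0 < M) (A : Mat N M) {m : ℝ}
    (hm : 0 ≤ m) (h : ∀ u i, |A u i| ≤ m) : ‖A‖ ≤ N * M * m := by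
  refine le_of_sq_le_sq ?_ (by positivity)
  rw [sq_frobenius_norm]
  have hN' : (1 : ℝ) ≤ N := by exact_mod_cast hN
  have hM' : (1 : ℝ) ≤ M := by exact_mod_cast hM
  calc ∑ u, ∑ i, A u i ^ 2 ≤ ∑ _u : Fin N, ∑ _i : Fin M, m ^ 2 :=
        Finset.sum_le_sum fun u _ => Finset.sum_le_sum fun i _ => sq_le_sq.2 (by
          rw [abs_of_nonneg hm]; exact h u i)
    _ = (N * M) * m ^ 2 := by simp; ring
    _ ≤ (N * M) ^ 2 * m ^ 2 := by
        gcongr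
        nlinarith [one_le_mul_of_one_le_of_one_le hN' hM']
    _ = _ := by ring

/-- Rounding the entries of both factors of a bounded factorization gives a cover of the low-rank
matrices. The grid widths are crude: they only enter the covering number through a logarithm. -/
theorem coveringNumber_lowRankSet_le {N M R : ℕ} {B : ℝ} (hN : 0 < N) (hM : 0 < M) (hB : 0 ≤ B)
    {α : ℝ} (hα : 0 < α) :
    Metric.coveringNumber α.toNNReal (lowRankSet N M R B) ≤
      (((⌊2 * (N * B + 1) / (α / (N ^ 2 * M * (N * B + 2)))⌋₊ + 1) ^ (R * (N + M)) : ℕ) : ℕ∞) := by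
  classical
  set Q : ℝ := N * B + 1 with hQ
  set ε : ℝ := α / (N ^ 2 * M * (N * B + 2)) with hε
  have hN' : (1 : ℝ) ≤ N := by exact_mod_cast hN
  have hM' : (1 : ℝ) ≤ M := by exact_mod_cast hM
  have hε0 : 0 < ε := by positivity
  set r := min R N with hr
  obtain ⟨c, hc⟩ := exists_rounding (Q := Q) hε0
  have hfac : ∀ Θ : lowRankSet N M R B, ∃ (A : Matrix (Fin N) (Fin r) ℝ)
      (W : Matrix (Fin r) (Fin M) ℝ), (Θ : Mat N M) = A * W ∧
      (∀ u k, |A u k| ≤ 1) ∧ ∀ k i, |W k i| ≤ N * B := fun Θ =>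
    exists_bounded_factorization _ (le_min Θ.2.1 (by simpa using Θ.1.rank_le_height))
      fun u i => abs_le.2 ⟨by linarith [(Θ.2.2 u i).1], (Θ.2.2 u i).2⟩
  choose A W hAW hA hW using hfac
  let f : Mat N M → (Fin N × Fin r) ⊕ (Fin r × Fin M) → Fin (⌊2 * Q / ε⌋₊ + 1) := fun Θ =>
    if h : Θ ∈ lowRankSet N M R B then
      Sum.elim (fun p => c (A ⟨Θ, h⟩ p.1 p.2)) (fun p => c (W ⟨Θ, h⟩ p.1 p.2))
    else fun _ => 0
  refine (coveringNumber_le_card_of_code _ _ f ?_).trans ?_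
  · intro Θ hΘ Θ' hΘ' hff
    simp only [f, dif_pos hΘ, dif_pos hΘ'] at hff
    have hNB : 0 ≤ N * B := by positivity
    have hdA : ∀ u k, |A ⟨Θ, hΘ⟩ u k - A ⟨Θ', hΘ'⟩ u k| ≤ ε := fun u k =>
      hc _ _ ((hA _ _ _).trans (by linarith)) ((hA _ _ _).trans (by linarith))
        (congrFun hff (Sum.inl (u, k)))
    have hdW : ∀ k i, |W ⟨Θ, hΘ⟩ k i - W ⟨Θ', hΘ'⟩ k i| ≤ ε := fun k i =>
      hc _ _ ((hW _ _ _).trans (by linarith)) ((hW _ _ _).trans (by linarith))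
        (congrFun hff (Sum.inr (k, i)))
    have hent : ∀ u i, |(Θ - Θ') u i| ≤ N * (ε * (N * B + 2)) := fun u i => by
      have h1 : Θ = A ⟨Θ, hΘ⟩ * W ⟨Θ, hΘ⟩ := hAW ⟨Θ, hΘ⟩
      have h2 : Θ' = A ⟨Θ', hΘ'⟩ * W ⟨Θ', hΘ'⟩ := hAW ⟨Θ', hΘ'⟩
      have h3 : (Θ - Θ') u i = ∑ k, ((A ⟨Θ, hΘ⟩ u k - A ⟨Θ', hΘ'⟩ u k) * W ⟨Θ, hΘ⟩ k i
          + A ⟨Θ', hΘ'⟩ u k * (W ⟨Θ, hΘ⟩ k i - W ⟨Θ', hΘ'⟩ k i)) := by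
        rw [Matrix.sub_apply, congrFun (congrFun h1 u) i, congrFun (congrFun h2 u) i,
          Matrix.mul_apply, Matrix.mul_apply, ← Finset.sum_sub_distrib]
        exact Finset.sum_congr rfl fun k _ => by ring
      rw [h3]
      calc _ ≤ ∑ k, |(A ⟨Θ, hΘ⟩ u k - A ⟨Θ', hΘ'⟩ u k) * W ⟨Θ, hΘ⟩ k i
          + A ⟨Θ', hΘ'⟩ u k * (W ⟨Θ, hΘ⟩ k i - W ⟨Θ', hΘ'⟩ k i)| :=
            Finset.abs_sum_le_sum_abs _ _
        _ ≤ ∑ _k : Fin r, ε * (N * B + 2) := Finset.sum_le_sum fun k _ => by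
            refine (abs_add_le _ _).trans ?_
            rw [abs_mul, abs_mul]
            have e1 := mul_le_mul (hdA u k) (hW ⟨Θ, hΘ⟩ k i) (abs_nonneg _) hε0.le
            have e2 := mul_le_mul (hA ⟨Θ', hΘ'⟩ u k) (hdW k i) (abs_nonneg _) zero_le_one
            nlinarith
        _ = r * (ε * (N * B + 2)) := by simp
        _ ≤ N * (ε * (N * B + 2)) := by
            gcongr
            exact_mod_cast min_le_right R N
    have hdist : dist Θ Θ' ≤ α := by
      rw [dist_eq_norm]
      refine (frobenius_norm_le_of_abs_le hN hM _ (by positivity) hent).trans (le_of_eq ?_)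
      rw [hε]
      have : (N : ℝ) * B + 2 ≠ 0 := by positivity
      field_simp
    rw [edist_dist]
    exact ENNReal.ofReal_le_ofReal hdist
  · norm_cast
    simp only [Fintype.card_pi, Finset.prod_const, Fintype.card_fin, Finset.card_univ,
      Fintype.card_sum, Fintype.card_prod]
    refine Nat.pow_le_pow_right (Nat.succ_pos _) ?_
    calc N * r + r * M = r * (N + M) := by ring
      _ ≤ R * (N + M) := Nat.mul_le_mul_right _ (min_le_left _ _)

/-- The metric entropy of the low-rank matrices at scale `1 / (N M T)`. -/
theorem log_covNum_lowRankSet_le {N M T R : ℕ} {B : ℝ} (hN : 0 < N) (hM : 0 < M) (hT : 0 < T)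
    (hB : 0 ≤ B) :
    Real.log (covNum (lowRankSet N M R B) (1 / ((N : ℝ) * M * T))) ≤
      (Real.log (3 * (B + 2) ^ 2) / Real.log 2 + 5) * (R * (N + M))
        * Real.log (1 + (N : ℝ) * M * T) := by
  have hN' : (1 : ℝ) ≤ N := by exact_mod_cast hN
  have hM' : (1 : ℝ) ≤ M := by exact_mod_cast hM
  have hT' : (1 : ℝ) ≤ T := by exact_mod_cast hT
  set x : ℝ := (N : ℝ) * M * T with hx
  have hx1 : 1 ≤ x := one_le_mul_of_one_le_of_one_le (one_le_mul_of_one_le_of_one_le hN' hM') hT'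
  have hα : 0 < 1 / x := by positivity
  have hcov := coveringNumber_lowRankSet_le (R := R) hN hM hB hα
  set K : ℕ := ⌊2 * (N * B + 1) / (1 / x / (N ^ 2 * M * (N * B + 2)))⌋₊ + 1 with hK
  have hle : covNum (lowRankSet N M R B) (1 / x) ≤ K ^ (R * (N + M)) :=
    ENat.toNat_le_of_le_natCast hcov
  have hl2 : 0 < Real.log 2 := Real.log_pos one_lt_two
  have hl : Real.log 2 ≤ Real.log (1 + x) := Real.log_le_log (by norm_num) (by linarith)
  have hKle : (K : ℝ) ≤ 3 * (B + 2) ^ 2 * x ^ 5 := by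
    have hNx : (N : ℝ) ≤ x := by
      rw [hx, mul_assoc]
      exact le_mul_of_one_le_right (by linarith) (one_le_mul_of_one_le_of_one_le hM' hT')
    have hNMx : (N : ℝ) * M ≤ x := le_mul_of_one_le_right (by positivity) hT'
    have h1 : (K : ℝ) ≤ 2 * (N * B + 1) / (1 / x / (N ^ 2 * M * (N * B + 2))) + 1 := by
      rw [hK]; push_cast
      gcongr
      exact Nat.floor_le (by positivity)
    have h2 : 2 * (N * B + 1) / (1 / x / (N ^ 2 * M * (N * B + 2)))
        = 2 * (N * B + 1) * (N * B + 2) * N * (N * M) * x := by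
      have : (N : ℝ) * B + 2 ≠ 0 := by positivity
      field_simp
    have h3 : (N : ℝ) * B + 1 ≤ x * (B + 2) := by nlinarith
    have h4 : (N : ℝ) * B + 2 ≤ x * (B + 2) := by nlinarith
    have h5 : 2 * (N * B + 1) * (N * B + 2) * N * (N * M) * x
        ≤ 2 * (x * (B + 2)) * (x * (B + 2)) * x * x * x := by gcongr
    have h6 : (1 : ℝ) ≤ (B + 2) ^ 2 * x ^ 5 :=
      one_le_mul_of_one_le_of_one_le (one_le_pow₀ (by linarith)) (one_le_pow₀ hx1)
    nlinarith
  have hK1 : (1 : ℝ) ≤ K := by exact_mod_cast Nat.succ_pos _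
  have hlogK : Real.log K ≤ (Real.log (3 * (B + 2) ^ 2) / Real.log 2 + 5) * Real.log (1 + x) := by
    have hc : 0 ≤ Real.log (3 * (B + 2) ^ 2) := Real.log_nonneg (by nlinarith)
    calc Real.log K ≤ Real.log (3 * (B + 2) ^ 2 * x ^ 5) :=
          Real.log_le_log (by linarith) hKle
      _ = Real.log (3 * (B + 2) ^ 2) + 5 * Real.log x := by
          rw [Real.log_mul (by positivity) (by positivity), Real.log_pow]; norm_num
      _ ≤ Real.log (3 * (B + 2) ^ 2) / Real.log 2 * Real.log (1 + x) + 5 * Real.log (1 + x) := by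
          have : Real.log x ≤ Real.log (1 + x) := Real.log_le_log (by linarith) (by linarith)
          have h7 : Real.log (3 * (B + 2) ^ 2)
              = Real.log (3 * (B + 2) ^ 2) / Real.log 2 * Real.log 2 := by field_simp
          have h8 : Real.log (3 * (B + 2) ^ 2) / Real.log 2 * Real.log 2
              ≤ Real.log (3 * (B + 2) ^ 2) / Real.log 2 * Real.log (1 + x) :=
            mul_le_mul_of_nonneg_left hl (by positivity)
          linarith
      _ = _ := by ring
  rcases Nat.eq_zero_or_pos (covNum (lowRankSet N M R B) (1 / x)) with h0 | hpos
  · rw [h0]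
    have hc : 0 ≤ Real.log (3 * (B + 2) ^ 2) := Real.log_nonneg (by nlinarith)
    have : 0 ≤ Real.log (1 + x) := hl2.le.trans hl
    simp only [Nat.cast_zero, Real.log_zero]
    positivity
  · calc Real.log (covNum (lowRankSet N M R B) (1 / x))
        ≤ Real.log ((K : ℝ) ^ (R * (N + M))) :=
          Real.log_le_log (by exact_mod_cast hpos) (by exact_mod_cast hle)
      _ = (R * (N + M)) * Real.log K := by rw [Real.log_pow]; push_cast; ring
      _ ≤ (R * (N + M)) * ((Real.log (3 * (B + 2) ^ 2) / Real.log 2 + 5) * Real.log (1 + x)) :=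
          mul_le_mul_of_nonneg_left hlogK (by positivity)
      _ = _ := by ring

/-- A minimal cover of the low-rank matrices, as a nonempty finite set. -/
theorem exists_cover_lowRankSet {N M R : ℕ} {B : ℝ} (hN : 0 < N) (hM : 0 < M) (hB : 0 ≤ B)
    {α : ℝ} (hα : 0 < α) (hne : (lowRankSet N M R B).Nonempty) :
    ∃ S : Finset (Mat N M), S.card = covNum (lowRankSet N M R B) α ∧ 0 < S.card ∧
      (∀ Θ ∈ S, Θ ∈ lowRankSet N M R B) ∧
      ∀ Θ ∈ lowRankSet N M R B, ∃ Θ' ∈ S, ‖Θ - Θ'‖ ≤ α := by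
  have hfin : Metric.coveringNumber α.toNNReal (lowRankSet N M R B) ≠ ⊤ :=
    ((coveringNumber_lowRankSet_le (R := R) hN hM hB hα).trans_lt (ENat.natCast_lt_top _)).ne
  have hF := Metric.finite_minimalCover (ε := α.toNNReal) (A := lowRankSet N M R B)
  have hcov := Metric.isCover_minimalCover hfin
  have hmem : ∀ Θ ∈ lowRankSet N M R B, ∃ Θ' ∈ hF.toFinset, ‖Θ - Θ'‖ ≤ α := fun Θ hΘ => by
    obtain ⟨Θ', h1, h2⟩ := hcov hΘ
    refine ⟨Θ', hF.mem_toFinset.2 h1, ?_⟩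
    rw [← dist_eq_norm]
    have h2' : edist Θ Θ' ≤ ENNReal.ofReal α := h2
    rwa [edist_dist, ENNReal.ofReal_le_ofReal_iff hα.le] at h2'
  refine ⟨hF.toFinset, ?_, ?_, fun Θ h => Metric.minimalCover_subset (hF.mem_toFinset.1 h), hmem⟩
  · rw [covNum, ← Metric.encard_minimalCover hfin, hF.encard_eq_coe_toFinset_card]
    simp
  · obtain ⟨Θ, hΘ⟩ := hne
    obtain ⟨Θ', h, -⟩ := hmem Θ hΘ
    exact Finset.card_pos.2 ⟨_, h⟩

/-! ### Ville's inequality for predictable weights -/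

/-- Weights `w τ x p`, computed from a noise path `x`, that are measurable and depend only on the
rounds of the path before `τ`. -/
def Predictable {ι : Type*} (w : ℕ → (ℕ → ι → ℝ) → ι → ℝ) : Prop :=
  ∀ τ, Measurable (w τ) ∧ ∀ x y : ℕ → ι → ℝ, (∀ σ < τ, x σ = y σ) → w τ x = w τ y

/-- The logarithm after `n` rounds of the exponential supermartingale with weights `w` for noise
with variance proxy `η²`. -/
noncomputable def logWealth {ι : Type*} [Fintype ι] (η : ℝ) (w : ℕ → (ℕ → ι → ℝ) → ι → ℝ) (n : ℕ)
    (x : ℕ → ι → ℝ) : ℝ :=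
  ∑ τ ∈ Finset.range n, ∑ p, (w τ x p * x τ p - η ^ 2 * w τ x p ^ 2 / 2)

section

variable {ι : Type*} [Fintype ι] {η : ℝ} {w : ℕ → (ℕ → ι → ℝ) → ι → ℝ}

theorem logWealth_succ (n : ℕ) (x : ℕ → ι → ℝ) :
    logWealth η w (n + 1) x
      = logWealth η w n x + ∑ p, (w n x p * x n p - η ^ 2 * w n x p ^ 2 / 2) :=
  Finset.sum_range_succ _ _

theorem logWealth_congr (hw : Predictable w) {n : ℕ} {x y : ℕ → ι → ℝ}
    (h : ∀ σ < n, x σ = y σ) : logWealth η w n x = logWealth η w n y := by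
  refine Finset.sum_congr rfl fun τ hτ => ?_
  have hτ' := Finset.mem_range.1 hτ
  rw [(hw τ).2 x y fun σ hσ => h σ (hσ.trans hτ'), h τ hτ']

theorem measurable_logWealth (hw : Predictable w) (n : ℕ) : Measurable (logWealth η w n) := by
  refine Finset.measurable_sum _ fun τ _ => Finset.measurable_sum _ fun p _ => ?_
  have h1 : Measurable fun x : ℕ → ι → ℝ => w τ x p := (measurable_pi_apply p).comp (hw τ).1
  have h2 : Measurable fun x : ℕ → ι → ℝ => x τ p :=
    (measurable_pi_apply p).comp (measurable_pi_apply τ)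
  fun_prop

end

/-- For independent sub-Gaussian noise and fixed weights, one factor of the exponential
supermartingale has mean at most one. -/
theorem lintegral_exp_weighted_noise_le_one {ι Ω : Type*} [Fintype ι] [MeasurableSpace Ω]
    {μ : Measure Ω} [IsProbabilityMeasure μ] {η : ℝ≥0} {Z : Ω → ι → ℝ}
    (hind : iIndepFun (fun p ω => Z ω p) μ)
    (hsub : ∀ p, HasSubgaussianMGF (fun ω => Z ω p) (η ^ 2) μ) (v : ι → ℝ) :
    ∫⁻ ω, ENNReal.ofReal (Real.exp (∑ p, (v p * Z ω p - (η : ℝ) ^ 2 * v p ^ 2 / 2))) ∂μ ≤ 1 := by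
  have hind' : iIndepFun (fun p ω => v p * Z ω p) μ :=
    hind.comp (fun p z => v p * z) fun p => measurable_const_mul _
  have hS := HasSubgaussianMGF.sum_of_iIndepFun hind' (s := Finset.univ)
    fun p _ => (hsub p).const_mul (v p)
  have hint := hS.integrable_exp_mul 1
  have hmgf := hS.mgf_le 1
  simp only [one_mul, mgf] at hint hmgf
  set c : ℝ := ∑ p, (η : ℝ) ^ 2 * v p ^ 2 / 2 with hc
  have e : ∀ ω, Real.exp (∑ p, (v p * Z ω p - (η : ℝ) ^ 2 * v p ^ 2 / 2))
      = Real.exp (-c) * Real.exp (∑ p, v p * Z ω p) := fun ω => by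
    rw [Finset.sum_sub_distrib, ← Real.exp_add]
    congr 1; ring
  simp_rw [e]
  rw [← ofReal_integral_eq_lintegral_ofReal (hint.const_mul _)
    (Filter.Eventually.of_forall fun ω => by positivity), integral_const_mul,
    ← ENNReal.ofReal_one]
  refine ENNReal.ofReal_le_ofReal ?_
  calc _ ≤ Real.exp (-c) * Real.exp c := by
        refine mul_le_mul_of_nonneg_left (hmgf.trans (le_of_eq ?_)) (Real.exp_pos _).le
        congr 1
        rw [hc]
        push_cast
        rw [one_pow, mul_one, Finset.sum_div]
        refine Finset.sum_congr rfl fun p _ => ?_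
        change v p ^ 2 * (η : ℝ) ^ 2 / 2 = _
        ring
    _ = 1 := by rw [← Real.exp_add]; simp

/-- Predictable weights turn independent sub-Gaussian noise into an exponential supermartingale:
conditionally on the past, the noise of the current round is fresh. -/
theorem lintegral_exp_logWealth_le_one {ι Ω : Type*} [Fintype ι] [MeasurableSpace Ω]
    {μ : Measure Ω} [IsProbabilityMeasure μ] {η : ℝ≥0} {ε : Ω → ℕ → ι → ℝ}
    (hmeas : ∀ τ p, Measurable fun ω => ε ω τ p)
    (hind : iIndepFun (fun (q : ℕ × ι) ω => ε ω q.1 q.2) μ)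
    (hsub : ∀ τ p, HasSubgaussianMGF (fun ω => ε ω τ p) (η ^ 2) μ)
    {w : ℕ → (ℕ → ι → ℝ) → ι → ℝ} (hw : Predictable w) (n : ℕ) :
    ∫⁻ ω, ENNReal.ofReal (Real.exp (logWealth η w n (ε ω))) ∂μ ≤ 1 := by
  classical
  induction n with
  | zero => simp [logWealth]
  | succ n ih =>
    let S : Finset (ℕ × ι) := Finset.range n ×ˢ Finset.univ
    let S' : Finset (ℕ × ι) := {n} ×ˢ Finset.univ
    have hdisj : Disjoint S S' := by
      refine Finset.disjoint_left.2 fun q h1 h2 => ?_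
      simp only [S, S', Finset.mem_product, Finset.mem_range, Finset.mem_singleton] at h1 h2
      omega
    let Y : Ω → S → ℝ := fun ω q => ε ω q.1.1 q.1.2
    let Z : Ω → ι → ℝ := fun ω => ε ω n
    -- `ext` rebuilds a noise path from its first `n` rounds.
    let ext : (S → ℝ) → ℕ → ι → ℝ := fun y τ p => if h : (τ, p) ∈ S then y ⟨(τ, p), h⟩ else 0
    have hext : Measurable ext := by
      refine measurable_pi_iff.2 fun τ => measurable_pi_iff.2 fun p => ?_
      by_cases h : (τ, p) ∈ S
      · simpa [ext, h] using measurable_pi_apply (⟨(τ, p), h⟩ : S)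
      · simp [ext, h]
    have hYm : Measurable Y := measurable_pi_iff.2 fun q => hmeas _ _
    have hZm : Measurable Z := measurable_pi_iff.2 fun p => hmeas _ _
    have hYZ : IndepFun Y Z μ := by
      have h := hind.indepFun_finset S S' hdisj fun q => hmeas _ _
      let ψ : (S' → ℝ) → ι → ℝ := fun z p => z ⟨(n, p), by simp [S']⟩
      have hψ : Measurable ψ := measurable_pi_iff.2 fun p => measurable_pi_apply _
      exact h.comp measurable_id hψ
    have hpast : ∀ ω, ∀ σ < n, ε ω σ = ext (Y ω) σ := fun ω σ hσ => by
      funext p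
      simp [ext, S, Y, hσ]
    let g : (S → ℝ) × (ι → ℝ) → ENNReal := fun q =>
      ENNReal.ofReal (Real.exp (logWealth η w n (ext q.1))) * ENNReal.ofReal (Real.exp
        (∑ p, (w n (ext q.1) p * q.2 p - (η : ℝ) ^ 2 * w n (ext q.1) p ^ 2 / 2)))
    have hwp : ∀ p, Measurable fun q : (S → ℝ) × (ι → ℝ) => w n (ext q.1) p := fun p =>
      (measurable_pi_apply p).comp ((hw n).1.comp (hext.comp measurable_fst))
    have hg1 : Measurable fun y : S → ℝ =>
        ENNReal.ofReal (Real.exp (logWealth η w n (ext y))) :=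
      ((measurable_logWealth hw n).comp hext).exp.ennreal_ofReal
    have hg : Measurable g := by
      refine (hg1.comp measurable_fst).mul (Measurable.ennreal_ofReal (Measurable.exp ?_))
      refine Finset.measurable_sum _ fun p _ => ?_
      have h1 := hwp p
      have h2 : Measurable fun q : (S → ℝ) × (ι → ℝ) => q.2 p :=
        (measurable_pi_apply p).comp measurable_snd
      exact (h1.mul h2).sub (((h1.pow_const 2).const_mul _).div_const _)
    have hZ1 : ∀ v : ι → ℝ, ∫⁻ z, ENNReal.ofReal (Real.exp
        (∑ p, (v p * z p - (η : ℝ) ^ 2 * v p ^ 2 / 2))) ∂(μ.map Z) ≤ 1 := fun v => by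
      rw [lintegral_map (by fun_prop) hZm]
      exact lintegral_exp_weighted_noise_le_one
        (hind.precomp (g := fun p => (n, p)) (fun a b h => (Prod.mk.inj h).2))
        (fun p => hsub n p) v
    calc ∫⁻ ω, ENNReal.ofReal (Real.exp (logWealth η w (n + 1) (ε ω))) ∂μ
        = ∫⁻ ω, g (Y ω, Z ω) ∂μ := by
          refine lintegral_congr fun ω => ?_
          rw [logWealth_succ, Real.exp_add, ENNReal.ofReal_mul (Real.exp_pos _).le,
            logWealth_congr hw (hpast ω), (hw n).2 _ _ (hpast ω)]
      _ = ∫⁻ q, g q ∂((μ.map Y).prod (μ.map Z)) := by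
          rw [← (indepFun_iff_map_prod_eq_prod_map_map hYm.aemeasurable hZm.aemeasurable).1 hYZ,
            lintegral_map hg (hYm.prodMk hZm)]
      _ = ∫⁻ y, ∫⁻ z, g (y, z) ∂(μ.map Z) ∂(μ.map Y) := by
          have : IsProbabilityMeasure (μ.map Z) := Measure.isProbabilityMeasure_map hZm.aemeasurable
          exact lintegral_prod _ hg.aemeasurable
      _ ≤ ∫⁻ y, ENNReal.ofReal (Real.exp (logWealth η w n (ext y))) ∂(μ.map Y) := by
          refine lintegral_mono fun y => ?_
          simp only [g]
          rw [lintegral_const_mul' _ _ ENNReal.ofReal_ne_top]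
          exact mul_le_of_le_one_right' (hZ1 _)
      _ = ∫⁻ ω, ENNReal.ofReal (Real.exp (logWealth η w n (ε ω))) ∂μ := by
          rw [lintegral_map hg1 hYm]
          exact lintegral_congr fun ω => by rw [logWealth_congr hw (hpast ω)]
      _ ≤ 1 := ih

/-- Ville's inequality for the exponential supermartingale, over a finite horizon. Betting stops
(the weights are set to zero) once the level `c` is reached, so that Markov's inequality for the
stopped process at the horizon controls all earlier times at once. -/
theorem measure_exists_logWealth_ge_le {ι Ω : Type*} [Fintype ι] [MeasurableSpace Ω]
    {μ : Measure Ω} [IsProbabilityMeasure μ] {η : ℝ≥0} {ε : Ω → ℕ → ι → ℝ}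
    (hmeas : ∀ τ p, Measurable fun ω => ε ω τ p)
    (hind : iIndepFun (fun (q : ℕ × ι) ω => ε ω q.1 q.2) μ)
    (hsub : ∀ τ p, HasSubgaussianMGF (fun ω => ε ω τ p) (η ^ 2) μ)
    {w : ℕ → (ℕ → ι → ℝ) → ι → ℝ} (hw : Predictable w) (T : ℕ) (c : ℝ) :
    μ {ω | ∃ n ≤ T, c ≤ logWealth η w n (ε ω)} ≤ ENNReal.ofReal (Real.exp (-c)) := by
  classical
  let w' : ℕ → (ℕ → ι → ℝ) → ι → ℝ := fun τ x =>
    if ∀ m ≤ τ, logWealth η w m x < c then w τ x else 0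
  have hw' : Predictable w' := fun τ => by
    refine ⟨Measurable.ite ?_ (hw τ).1 measurable_const, fun x y hxy => ?_⟩
    · simp only [Set.ofPred_forall]
      exact MeasurableSet.iInter fun m => MeasurableSet.iInter fun _ =>
        measurableSet_lt (measurable_logWealth hw m) measurable_const
    · have : (∀ m ≤ τ, logWealth η w m x < c) ↔ ∀ m ≤ τ, logWealth η w m y < c :=
        forall₂_congr fun m hm => by
          rw [logWealth_congr hw fun σ hσ => hxy σ (hσ.trans_le hm)]
      simp only [w', this, (hw τ).2 x y hxy]
  have hcross : ∀ x, (∃ n ≤ T, c ≤ logWealth η w n x) → c ≤ logWealth η w' T x := by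
    rintro x ⟨n, hnT, hn⟩
    have hex : ∃ n, c ≤ logWealth η w n x := ⟨n, hn⟩
    set m := Nat.find hex with hm
    have hmc : c ≤ logWealth η w m x := Nat.find_spec hex
    have hmT : m ≤ T := (Nat.find_min' hex hn).trans hnT
    have h1 : logWealth η w' m x = logWealth η w m x := by
      refine Finset.sum_congr rfl fun τ hτ => ?_
      have : ∀ k ≤ τ, logWealth η w k x < c := fun k hk =>
        not_le.1 (Nat.find_min hex (hk.trans_lt (Finset.mem_range.1 hτ)))
      simp only [w', if_pos this]
    have h2 : logWealth η w' T x = logWealth η w' m x := by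
      refine (Finset.sum_subset (Finset.range_mono hmT) fun τ _ hτ => ?_).symm
      have hmτ : m ≤ τ := not_lt.1 fun h => hτ (Finset.mem_range.2 h)
      have : ¬ ∀ k ≤ τ, logWealth η w k x < c := fun h => (h m hmτ).not_ge hmc
      simp only [w', if_neg this]
      simp
    rw [h2, h1]
    exact hmc
  have hεm : Measurable ε := measurable_pi_iff.2 fun τ => measurable_pi_iff.2 fun p => hmeas τ p
  have hm : AEMeasurable (fun ω => ENNReal.ofReal (Real.exp (logWealth η w' T (ε ω)))) μ :=
    ((measurable_logWealth hw' T).comp hεm).exp.ennreal_ofReal.aemeasurable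
  calc μ {ω | ∃ n ≤ T, c ≤ logWealth η w n (ε ω)}
      ≤ μ {ω | ENNReal.ofReal (Real.exp c) ≤
          ENNReal.ofReal (Real.exp (logWealth η w' T (ε ω)))} :=
        measure_mono fun ω h => ENNReal.ofReal_le_ofReal (Real.exp_le_exp.2 (hcross _ h))
    _ ≤ (∫⁻ ω, ENNReal.ofReal (Real.exp (logWealth η w' T (ε ω))) ∂μ) /
          ENNReal.ofReal (Real.exp c) :=
        meas_ge_le_lintegral_div hm (by simp [Real.exp_pos]) ENNReal.ofReal_ne_top
    _ ≤ 1 / ENNReal.ofReal (Real.exp c) := by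
        gcongr
        exact lintegral_exp_logWealth_le_one hmeas hind hsub hw' T
    _ = ENNReal.ofReal (Real.exp (-c)) := by
        rw [one_div, Real.exp_neg, ENNReal.ofReal_inv_of_pos (Real.exp_pos c)]

/-! ### Histories of a policy -/

theorem mem_arms {N M : ℕ} {X : Mat N M} {p : Fin N × Fin M} : p ∈ arms X ↔ X p.1 p.2 = 1 := by
  simp [arms]

theorem measurable_mat_entry {N M : ℕ} (u : Fin N) (i : Fin M) :
    Measurable fun X : Mat N M => X u i :=
  (measurable_pi_apply (X := fun _ : Fin M => ℝ) i).comp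
    (measurable_pi_apply (X := fun _ : Fin N => Fin M → ℝ) u)

theorem measurable_mat_of_entries {α : Type*} [MeasurableSpace α] {N M : ℕ} {f : α → Mat N M}
    (h : ∀ u i, Measurable fun a => f a u i) : Measurable f :=
  measurable_pi_lambda (X := fun _ : Fin N => Fin M → ℝ) f fun u =>
    measurable_pi_lambda (X := fun _ : Fin M => ℝ) _ fun i => h u i

theorem measurableSet_mem_arms {α : Type*} [MeasurableSpace α] {N M : ℕ} {X : α → Mat N M}
    (hX : Measurable X) (p : Fin N × Fin M) : MeasurableSet {a | p ∈ arms (X a)} := by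
  simp only [mem_arms]
  exact (measurable_mat_entry p.1 p.2).comp hX (measurableSet_singleton 1)

theorem measurable_observed {α : Type*} [MeasurableSpace α] {N M : ℕ} {X r : α → Mat N M}
    (hX : Measurable X) (hr : Measurable r) : Measurable fun a => observed (X a) (r a) :=
  measurable_mat_of_entries fun u i =>
    Measurable.ite (measurableSet_mem_arms hX (u, i)) ((measurable_mat_entry u i).comp hr)
      measurable_const

theorem measurable_playedHistory {α : Type*} [MeasurableSpace α] {N M : ℕ} {π : Policy N M}
    (hπ : ∀ s, Measurable (π s)) {ρ : α → ℕ → Mat N M} (hρ : ∀ s, Measurable fun a => ρ a s)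
    (s : ℕ) : Measurable fun a => playedHistory π (ρ a) s := by
  induction s with
  | zero => exact measurable_pi_lambda _ fun τ => τ.elim0
  | succ s ih =>
    refine measurable_pi_lambda _ fun τ => ?_
    simp only [playedHistory]
    refine Fin.lastCases ?_ (fun τ => ?_) τ
    · simp only [Fin.snoc_last]
      exact ((hπ s).comp ih).prodMk (measurable_observed ((hπ s).comp ih) (hρ s))
    · simp only [Fin.snoc_castSucc]
      exact (measurable_pi_apply τ).comp ih

theorem measurable_played {α : Type*} [MeasurableSpace α] {N M : ℕ} {π : Policy N M}
    (hπ : ∀ s, Measurable (π s)) {ρ : α → ℕ → Mat N M} (hρ : ∀ s, Measurable fun a => ρ a s)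
    (s : ℕ) : Measurable fun a => played π (ρ a) s :=
  (hπ s).comp (measurable_playedHistory hπ hρ s)

theorem playedHistory_congr {N M : ℕ} (π : Policy N M) {r r' : ℕ → Mat N M} {s : ℕ}
    (h : ∀ σ < s, r σ = r' σ) : playedHistory π r s = playedHistory π r' s := by
  induction s with
  | zero => rfl
  | succ s ih =>
    simp only [playedHistory]
    rw [ih fun σ hσ => h σ (hσ.trans (Nat.lt_succ_self s)), h s (Nat.lt_succ_self s)]

theorem playedHistory_apply {N M : ℕ} (π : Policy N M) (r : ℕ → Mat N M) {s : ℕ} (τ : Fin s) :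
    playedHistory π r s τ = (played π r τ, observed (played π r τ) (r τ)) := by
  induction s with
  | zero => exact τ.elim0
  | succ s ih =>
    simp only [playedHistory]
    refine Fin.lastCases ?_ (fun τ => ?_) τ
    · simp [played]
    · simp [ih]

theorem squaredError_playedHistory {N M : ℕ} (π : Policy N M) (r : ℕ → Mat N M) (s : ℕ)
    (Θ : Mat N M) :
    squaredError (playedHistory π r s) Θ =
      ∑ τ ∈ Finset.range s, ∑ p ∈ arms (played π r τ), (Θ p.1 p.2 - r τ p.1 p.2) ^ 2 := by
  rw [squaredError, ← Fin.sum_univ_eq_sum_range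
    (fun τ => ∑ p ∈ arms (played π r τ), (Θ p.1 p.2 - r τ p.1 p.2) ^ 2)]
  refine Finset.sum_congr rfl fun τ _ => ?_
  rw [playedHistory_apply]
  refine Finset.sum_congr rfl fun p hp => ?_
  simp [observed, hp]

theorem count_playedHistory {N M : ℕ} (π : Policy N M) (r : ℕ → Mat N M) (s : ℕ) (u : Fin N)
    (i : Fin M) :
    count (playedHistory π r s) u i =
      ∑ τ ∈ Finset.range s, if (u, i) ∈ arms (played π r τ) then 1 else 0 := by
  rw [count, Finset.card_filter,
    ← Fin.sum_univ_eq_sum_range (fun τ => if (u, i) ∈ arms (played π r τ) then 1 else 0)]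
  exact Finset.sum_congr rfl fun τ _ => by rw [playedHistory_apply]

/-- The squared regularized empirical norm, written as a sum over the played pairs. -/
theorem sum_count_add_one_mul_sq {N M : ℕ} (π : Policy N M) (r : ℕ → Mat N M) (s : ℕ)
    (Δ : Mat N M) :
    ∑ u, ∑ i, ((count (playedHistory π r s) u i : ℝ) + 1) * Δ u i ^ 2 =
      (∑ τ ∈ Finset.range s, ∑ p ∈ arms (played π r τ), Δ p.1 p.2 ^ 2) + ‖Δ‖ ^ 2 := by
  have h1 : ∀ τ, ∑ p ∈ arms (played π r τ), Δ p.1 p.2 ^ 2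
      = ∑ u, ∑ i, if (u, i) ∈ arms (played π r τ) then Δ u i ^ 2 else 0 := fun τ => by
    rw [← Fintype.sum_prod_type' fun u i =>
      if (u, i) ∈ arms (played π r τ) then Δ u i ^ 2 else 0, ← Finset.sum_filter]
    simp
  simp_rw [h1, count_playedHistory, sq_frobenius_norm, add_mul, one_mul, Finset.sum_add_distrib]
  congr 1
  refine Eq.trans ?_ Finset.sum_comm
  refine Finset.sum_congr rfl fun u _ => ?_
  refine Eq.trans ?_ Finset.sum_comm
  refine Finset.sum_congr rfl fun i _ => ?_
  push_cast
  rw [Finset.sum_mul]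
  exact Finset.sum_congr rfl fun τ _ => by split_ifs <;> simp

/-! ### Confidence sets on good noise -/

/-- The noise realizations on which the confidence sets contain the mean matrix: for every point
of the cover `S` the linear part of the excess squared error is dominated in all rounds up to `T`,
and no single noise variable is exceptionally large. -/
def GoodNoise {N M : ℕ} (π : Policy N M) (r : ℕ → Mat N M) (Θstar : Mat N M)
    (S : Finset (Mat N M)) (η δ : ℝ) (T : ℕ) : Prop :=
  (∀ Θ ∈ S, ∀ n ≤ T, ∑ τ ∈ Finset.range n, ∑ p ∈ arms (played π r τ),
      (2 * (r τ p.1 p.2 - Θstar p.1 p.2) * (Θ p.1 p.2 - Θstar p.1 p.2)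
        - (Θ p.1 p.2 - Θstar p.1 p.2) ^ 2 / 2) ≤ 4 * η ^ 2 * Real.log (S.card / δ)) ∧
  ∀ τ < T, ∀ u i, |r τ u i - Θstar u i| ≤
    √(2 * η ^ 2 * Real.log (4 * (N * M) * ((τ : ℝ) + 1) ^ 2 / δ))

/-- On good noise, the mean matrix lies in the confidence ellipsoid of the least squares estimate.
The estimate is compared with the nearest point of the cover, at which the noise is controlled. -/
theorem sum_count_mul_sq_le_betaStar {N M R T s : ℕ} {B G η δ α : ℝ} {π : Policy N M}
    {r : ℕ → Mat N M} {Θstar Θbar Θhat : Mat N M} {S : Finset (Mat N M)}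
    (hB : 0 ≤ B) (hα : 0 ≤ α) (hδ : 0 < δ) (hN : 0 < N) (hM : 0 < M)
    (hS : S.card = covNum (lowRankSet N M R B) α)
    (hSL : ∀ Θ ∈ S, Θ ∈ lowRankSet N M R B)
    (hcov : ∀ Θ ∈ lowRankSet N M R B, ∃ Θ' ∈ S, ‖Θ - Θ'‖ ≤ α)
    (hgood : GoodNoise π r Θstar S η δ T) (hs : s < T)
    (hstar : Θstar ∈ lowRankSet N M R B) (hG : ‖Θbar - Θstar‖ ≤ G)
    (hls : IsLeastSquares (lowRankSet N M R B) Θbar 1 (playedHistory π r s) Θhat) :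
    ∑ u, ∑ i, ((count (playedHistory π r s) u i : ℝ) + 1) * (Θstar - Θhat) u i ^ 2 ≤
      betaStar (lowRankSet N M R B) η B G δ α 1 (s + 1) := by
  obtain ⟨Θ', hΘ'S, hΘ'⟩ := hcov Θhat hls.1
  have hN' : (1 : ℝ) ≤ N := by exact_mod_cast hN
  have hM' : (1 : ℝ) ≤ M := by exact_mod_cast hM
  set E : ℝ := √(8 * η ^ 2 * Real.log (4 * (N * M) * (((s + 1 : ℕ) : ℝ)) ^ 2 / δ)) with hE
  have hmin := hls.2 Θstar hstar
  rw [squaredError_playedHistory, squaredError_playedHistory, one_mul, one_mul] at hmin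
  have hcover := hgood.1 Θ' hΘ'S s hs.le
  have hnoise : ∀ τ ∈ Finset.range s, ∀ p : Fin N × Fin M,
      2 * |r τ p.1 p.2 - Θstar p.1 p.2| ≤ E := fun τ hτ p => by
    have hτ' : τ < s := Finset.mem_range.1 hτ
    have h1 := hgood.2 τ (hτ'.trans hs) p.1 p.2
    have h2 : E = 2 * √(2 * η ^ 2 * Real.log (4 * (N * M) * (((s + 1 : ℕ) : ℝ)) ^ 2 / δ)) := by
      rw [hE, show (8 : ℝ) * η ^ 2 * Real.log (4 * (N * M) * (((s + 1 : ℕ) : ℝ)) ^ 2 / δ)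
        = 2 ^ 2 * (2 * η ^ 2 * Real.log (4 * (N * M) * (((s + 1 : ℕ) : ℝ)) ^ 2 / δ)) by ring,
        Real.sqrt_mul (by norm_num), Real.sqrt_sq (by norm_num)]
    rw [h2]
    refine mul_le_mul_of_nonneg_left (h1.trans (Real.sqrt_le_sqrt ?_)) zero_le_two
    refine mul_le_mul_of_nonneg_left (Real.log_le_log (by positivity) ?_) (by positivity)
    have : (τ : ℝ) + 1 ≤ ((s + 1 : ℕ) : ℝ) := by push_cast; gcongr
    gcongr
  have hE0 : 0 ≤ E := Real.sqrt_nonneg _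
  -- The error of replacing the estimate by the point of the cover, in one played pair.
  have hpt : ∀ τ ∈ Finset.range s, ∀ p : Fin N × Fin M, (Θstar - Θhat) p.1 p.2 ^ 2 / 2 ≤
      ((Θhat p.1 p.2 - r τ p.1 p.2) ^ 2 - (Θstar p.1 p.2 - r τ p.1 p.2) ^ 2)
      + (2 * (r τ p.1 p.2 - Θstar p.1 p.2) * (Θ' p.1 p.2 - Θstar p.1 p.2)
        - (Θ' p.1 p.2 - Θstar p.1 p.2) ^ 2 / 2) + α * (E + B) := fun τ hτ p => by
    have hab : |Θhat p.1 p.2 - Θ' p.1 p.2| ≤ α :=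
      (abs_apply_le_frobenius_norm (Θhat - Θ') p.1 p.2).trans hΘ'
    have hn := hnoise τ hτ p
    obtain ⟨h1, h2⟩ := hls.1.2 p.1 p.2
    obtain ⟨h3, h4⟩ := (hSL Θ' hΘ'S).2 p.1 p.2
    obtain ⟨h5, h6⟩ := hstar.2 p.1 p.2
    rw [Matrix.sub_apply]
    set a := Θhat p.1 p.2
    set b := Θ' p.1 p.2
    set c := Θstar p.1 p.2
    set e := r τ p.1 p.2 - c with he
    have hr : r τ p.1 p.2 = c + e := by rw [he]; ring
    rw [hr]
    have k1 : (a - b) * (2 * e - (a + b - 2 * c) / 2) ≤ α * (E + B) := by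
      refine (le_abs_self _).trans ?_
      rw [abs_mul]
      refine mul_le_mul hab ?_ (abs_nonneg _) hα
      refine (abs_sub _ _).trans (add_le_add ?_ ?_)
      · rw [abs_mul, abs_two]; exact hn
      · rw [abs_le]; constructor <;> linarith
    nlinarith [k1]
  have hsum : (∑ τ ∈ Finset.range s, ∑ p ∈ arms (played π r τ), (Θstar - Θhat) p.1 p.2 ^ 2) / 2
      ≤ (∑ τ ∈ Finset.range s, ∑ p ∈ arms (played π r τ), (Θhat p.1 p.2 - r τ p.1 p.2) ^ 2
        - ∑ τ ∈ Finset.range s, ∑ p ∈ arms (played π r τ), (Θstar p.1 p.2 - r τ p.1 p.2) ^ 2)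
        + ∑ τ ∈ Finset.range s, ∑ p ∈ arms (played π r τ),
          (2 * (r τ p.1 p.2 - Θstar p.1 p.2) * (Θ' p.1 p.2 - Θstar p.1 p.2)
            - (Θ' p.1 p.2 - Θstar p.1 p.2) ^ 2 / 2)
        + ∑ τ ∈ Finset.range s, ∑ p ∈ arms (played π r τ), α * (E + B) := by
    simp only [Finset.sum_div, ← Finset.sum_sub_distrib, ← Finset.sum_add_distrib]
    exact Finset.sum_le_sum fun τ hτ => Finset.sum_le_sum fun p _ => hpt τ hτ p
  have hdisc : ∑ τ ∈ Finset.range s, ∑ p ∈ arms (played π r τ), α * (E + B)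
      ≤ s * (N * M) * (α * (E + B)) := by
    have hcard : ∀ τ, ((arms (played π r τ)).card : ℝ) ≤ N * M := fun τ => by
      have := Finset.card_le_univ (arms (played π r τ))
      simp only [Fintype.card_prod, Fintype.card_fin] at this
      exact_mod_cast this
    calc _ ≤ ∑ _τ ∈ Finset.range s, (N * M : ℝ) * (α * (E + B)) :=
          Finset.sum_le_sum fun τ _ => by
            rw [Finset.sum_const, nsmul_eq_mul]
            exact mul_le_mul_of_nonneg_right (hcard τ) (by positivity)
      _ = _ := by simp; ring
  have htri : ‖Θstar - Θhat‖ ^ 2 ≤ 2 * ‖Θstar - Θbar‖ ^ 2 + 2 * ‖Θhat - Θbar‖ ^ 2 := by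
    have h1 : ‖Θstar - Θhat‖ ≤ ‖Θstar - Θbar‖ + ‖Θhat - Θbar‖ := by
      rw [norm_sub_rev Θhat]
      exact norm_sub_le_norm_sub_add_norm_sub _ _ _
    nlinarith [norm_nonneg (Θstar - Θhat), sq_nonneg (‖Θstar - Θbar‖ - ‖Θhat - Θbar‖)]
  have hG2 : ‖Θstar - Θbar‖ ^ 2 ≤ G ^ 2 := by
    rw [norm_sub_rev]
    exact pow_le_pow_left₀ (norm_nonneg _) hG 2
  rw [sum_count_add_one_mul_sq, betaStar, ← hS, ← hE]
  have hlast : 2 * (s * (N * M) * (α * (E + B))) ≤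
      2 * α * ((s + 1 : ℕ) : ℝ) * (N * M) * (8 * B + E) := by
    have h1 : (s : ℝ) ≤ ((s + 1 : ℕ) : ℝ) := by push_cast; linarith
    calc 2 * (s * (N * M) * (α * (E + B))) = 2 * α * s * (N * M) * (B + E) := by ring
      _ ≤ _ := by gcongr; linarith
  linarith

/-! ### Probability of good noise -/

/-- The weights for which the exponential supermartingale tests the matrix `Θ` against the mean
matrix `Θstar`. The scale `1 / (2 η²)` balances the linear and the quadratic term. -/
noncomputable def testWeights {N M : ℕ} (π : Policy N M) (Θstar Θ : Mat N M) (η : ℝ) (τ : ℕ)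
    (x : ℕ → Fin N × Fin M → ℝ) (p : Fin N × Fin M) : ℝ :=
  if p ∈ arms (played π (fun σ => Matrix.of fun u i => Θstar u i + x σ (u, i)) τ) then
    (Θ p.1 p.2 - Θstar p.1 p.2) / (2 * η ^ 2) else 0

theorem predictable_testWeights {N M : ℕ} {π : Policy N M} (hπ : ∀ s, Measurable (π s))
    (Θstar Θ : Mat N M) (η : ℝ) : Predictable (testWeights π Θstar Θ η) := fun τ => by
  constructor
  · refine measurable_pi_lambda _ fun p => Measurable.ite
      (measurableSet_mem_arms (measurable_played hπ (fun σ => ?_) τ) p) measurable_const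
      measurable_const
    refine measurable_mat_of_entries fun u i => ?_
    have h : Measurable fun x : ℕ → Fin N × Fin M → ℝ => x σ (u, i) :=
      (measurable_pi_apply (u, i)).comp (measurable_pi_apply σ)
    exact h.const_add (Θstar u i)
  · intro x y hxy
    funext p
    have h : played π (fun σ => Matrix.of fun u i => Θstar u i + x σ (u, i)) τ
        = played π (fun σ => Matrix.of fun u i => Θstar u i + y σ (u, i)) τ :=
      congrArg (π τ) (playedHistory_congr π fun σ hσ => by rw [hxy σ hσ])
    simp only [testWeights, h]

/-- In terms of the rewards, the test wealth of `Θ` is the noise term that appears in `GoodNoise`. -/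
theorem logWealth_testWeights {N M : ℕ} (π : Policy N M) (Θstar Θ : Mat N M) {η : ℝ} (hη : η ≠ 0)
    (n : ℕ) (r : ℕ → Mat N M) :
    4 * η ^ 2 * logWealth η (testWeights π Θstar Θ η) n
        (fun τ p => r τ p.1 p.2 - Θstar p.1 p.2) =
      ∑ τ ∈ Finset.range n, ∑ p ∈ arms (played π r τ),
        (2 * (r τ p.1 p.2 - Θstar p.1 p.2) * (Θ p.1 p.2 - Θstar p.1 p.2)
          - (Θ p.1 p.2 - Θstar p.1 p.2) ^ 2 / 2) := by
  rw [logWealth, Finset.mul_sum]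
  refine Finset.sum_congr rfl fun τ _ => ?_
  have hr : (fun σ => Matrix.of fun u i => Θstar u i + (r σ u i - Θstar u i)) = r := by
    funext σ; ext u i; simp
  rw [Finset.mul_sum, ← Finset.sum_subset (Finset.subset_univ (arms (played π r τ)))]
  · refine Finset.sum_congr rfl fun p hp => ?_
    simp only [testWeights, hr, if_pos hp]
    field_simp
    ring
  · intro p _ hp
    simp only [testWeights, hr, if_neg hp]
    ring

theorem sum_inv_sq_le_two (T : ℕ) : ∑ τ ∈ Finset.range T, 1 / ((τ : ℝ) + 1) ^ 2 ≤ 2 := by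
  have h : ∑ τ ∈ Finset.range (T + 1), 1 / ((τ : ℝ) + 1) ^ 2 ≤ 2 - 1 / ((T : ℝ) + 1) := by
    induction T with
    | zero => norm_num
    | succ T ih =>
      rw [Finset.sum_range_succ]
      have key : 1 / (((T + 1 : ℕ) : ℝ) + 1) ^ 2
          ≤ 1 / ((T : ℝ) + 1) - 1 / (((T + 1 : ℕ) : ℝ) + 1) := by
        push_cast
        rw [div_sub_div _ _ (by positivity) (by positivity),
          div_le_div_iff₀ (by positivity) (by positivity)]
        nlinarith [T.cast_nonneg (α := ℝ)]
      linarith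
  have h1 : (0 : ℝ) ≤ 1 / ((T : ℝ) + 1) := by positivity
  have h2 : (0 : ℝ) ≤ 1 / ((T : ℝ) + 1) ^ 2 := by positivity
  rw [Finset.sum_range_succ] at h
  linarith

/-- The two-sided Chernoff bound. For `η = 0`, where the exponent of the general bound is the junk
value `x / 0`, it holds because the variable vanishes almost surely. -/
theorem measure_abs_gt_le {Ω : Type*} [MeasurableSpace Ω] {μ : Measure Ω}
    [IsProbabilityMeasure μ] {η : ℝ≥0} {X : Ω → ℝ} (hX : HasSubgaussianMGF X (η ^ 2) μ) {l : ℝ}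
    (hl : 0 ≤ l) :
    μ {ω | √(2 * (η : ℝ) ^ 2 * l) < |X ω|} ≤ ENNReal.ofReal (2 * Real.exp (-l)) := by
  rcases eq_or_ne η 0 with rfl | hη
  · have h0 : X =ᵐ[μ] 0 := HasSubgaussianMGF.ae_eq_zero_of_hasSubgaussianMGF_zero (by simpa using hX)
    have : μ {ω | √(2 * ((0 : ℝ≥0) : ℝ) ^ 2 * l) < |X ω|} = 0 := by
      refine measure_eq_zero_iff_ae_notMem.2 ?_
      filter_upwards [h0] with ω h
      simp [h]
    rw [this]; exact zero_le
  · have hη' : (0 : ℝ) < η := by positivity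
    set s : ℝ := √(2 * (η : ℝ) ^ 2 * l) with hs
    have hbound : Real.exp (-s ^ 2 / (2 * ((η ^ 2 : ℝ≥0) : ℝ))) = Real.exp (-l) := by
      rw [hs, Real.sq_sqrt (by positivity)]
      congr 1
      push_cast
      field_simp
    have h1 := hX.measure_ge_le (Real.sqrt_nonneg (2 * (η : ℝ) ^ 2 * l))
    have h2 := hX.neg.measure_ge_le (Real.sqrt_nonneg (2 * (η : ℝ) ^ 2 * l))
    rw [← hs, hbound] at h1 h2
    have hsub : {ω | s < |X ω|} ⊆ {ω | s ≤ X ω} ∪ {ω | s ≤ (-X) ω} := fun ω hω => by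
      rcases lt_abs.1 (show s < |X ω| from hω) with h | h
      · exact Or.inl h.le
      · exact Or.inr h.le
    calc μ {ω | s < |X ω|} ≤ μ {ω | s ≤ X ω} + μ {ω | s ≤ (-X) ω} :=
          (measure_mono hsub).trans (measure_union_le _ _)
      _ ≤ ENNReal.ofReal (Real.exp (-l)) + ENNReal.ofReal (Real.exp (-l)) := by
          rw [← ofReal_measureReal, ← ofReal_measureReal]
          gcongr
      _ = ENNReal.ofReal (2 * Real.exp (-l)) := by
          rw [← ENNReal.ofReal_add (Real.exp_pos _).le (Real.exp_pos _).le]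
          congr 1; ring

/-- Ville's inequality at level `log (#S / δ)` for each point of the cover, and a union bound. For
`η = 0` the test weights are degenerate, but the noise vanishes almost surely. -/
theorem measure_cover_deviation_le {N M T : ℕ} {Ω : Type*} [MeasurableSpace Ω] {μ : Measure Ω}
    [IsProbabilityMeasure μ] {η : ℝ≥0} {Θstar : Mat N M} {r : ℕ → Ω → Mat N M}
    (hr : IsRewardModel μ η Θstar r) {π : Policy N M} (hπ : ∀ s, Measurable (π s))
    {S : Finset (Mat N M)} (hS : 0 < S.card) {δ : ℝ} (hδ : 0 < δ) :
    μ {ω | ¬ ∀ Θ ∈ S, ∀ n ≤ T,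
      ∑ τ ∈ Finset.range n, ∑ p ∈ arms (played π (fun s => r s ω) τ),
        (2 * (r τ ω p.1 p.2 - Θstar p.1 p.2) * (Θ p.1 p.2 - Θstar p.1 p.2)
          - (Θ p.1 p.2 - Θstar p.1 p.2) ^ 2 / 2) ≤ 4 * (η : ℝ) ^ 2 * Real.log (S.card / δ)}
      ≤ ENNReal.ofReal δ := by
  have hS' : (0 : ℝ) < S.card := by exact_mod_cast hS
  rcases eq_or_ne η 0 with rfl | hη
  · have h0 : ∀ᵐ ω ∂μ, ∀ τ u i, r τ ω u i - Θstar u i = 0 := by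
      refine ae_all_iff.2 fun τ => ae_all_iff.2 fun u => ae_all_iff.2 fun i => ?_
      exact HasSubgaussianMGF.ae_eq_zero_of_hasSubgaussianMGF_zero
        (by simpa using hr.subGaussian τ u i)
    refine le_of_eq_of_le (measure_eq_zero_iff_ae_notMem.2 ?_) zero_le
    filter_upwards [h0] with ω h
    refine not_not.2 fun Θ _ n _ => ?_
    simp only [h, mul_zero, zero_mul, zero_sub, NNReal.coe_zero, ne_eq, OfNat.ofNat_ne_zero,
      not_false_eq_true, zero_pow]
    exact Finset.sum_nonpos fun τ _ => Finset.sum_nonpos fun p _ => by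
      have := sq_nonneg (Θ p.1 p.2 - Θstar p.1 p.2); linarith
  · have hη' : (0 : ℝ) < η := by positivity
    have hcentered : iIndepFun (fun (q : ℕ × Fin N × Fin M) ω =>
        r q.1 ω q.2.1 q.2.2 - Θstar q.2.1 q.2.2) μ :=
      hr.indep.comp (fun q z => z - Θstar q.2.1 q.2.2) fun q => measurable_id.sub_const _
    have hville : ∀ Θ ∈ S, μ {ω | ∃ n ≤ T, Real.log (S.card / δ) ≤
        logWealth η (testWeights π Θstar Θ η) n (fun τ p => r τ ω p.1 p.2 - Θstar p.1 p.2)}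
        ≤ ENNReal.ofReal (δ / S.card) := fun Θ _ => by
      have h := measure_exists_logWealth_ge_le (η := η)
        (ε := fun ω τ (p : Fin N × Fin M) => r τ ω p.1 p.2 - Θstar p.1 p.2)
        (fun τ p => (hr.measurable τ p.1 p.2).sub_const _) hcentered
        (fun τ p => hr.subGaussian τ p.1 p.2) (predictable_testWeights hπ Θstar Θ η) T
        (Real.log (S.card / δ))
      rwa [Real.exp_neg, Real.exp_log (by positivity), inv_div] at h
    calc _ ≤ μ (⋃ Θ ∈ S, {ω | ∃ n ≤ T, Real.log (S.card / δ) ≤ logWealth η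
          (testWeights π Θstar Θ η) n (fun τ p => r τ ω p.1 p.2 - Θstar p.1 p.2)}) := by
          refine measure_mono fun ω hω => ?_
          simp only [Set.mem_ofPred_eq, not_forall, not_le] at hω
          obtain ⟨Θ, hΘ, n, hn, hlt⟩ := hω
          refine Set.mem_biUnion hΘ ⟨n, hn, ?_⟩
          rw [← logWealth_testWeights π Θstar Θ hη'.ne' n (fun s => r s ω)] at hlt
          exact (lt_of_mul_lt_mul_left hlt (by positivity)).le
      _ ≤ ∑ Θ ∈ S, ENNReal.ofReal (δ / S.card) :=
          (measure_biUnion_finset_le _ _).trans (Finset.sum_le_sum hville)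
      _ = ENNReal.ofReal δ := by
          rw [← ENNReal.ofReal_sum_of_nonneg fun _ _ => by positivity]
          congr 1
          rw [Finset.sum_const, nsmul_eq_mul]
          field_simp

/-- A union bound over all noise variables; the thresholds grow with the round so that the failure
probabilities are summable. -/
theorem measure_large_noise_le {N M T : ℕ} {Ω : Type*} [MeasurableSpace Ω] {μ : Measure Ω}
    [IsProbabilityMeasure μ] {η : ℝ≥0} {Θstar : Mat N M} {r : ℕ → Ω → Mat N M}
    (hr : IsRewardModel μ η Θstar r) (hN : 0 < N) (hM : 0 < M) {δ : ℝ} (hδ : 0 < δ)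
    (hδ1 : δ ≤ 1) :
    μ {ω | ¬ ∀ τ < T, ∀ u i, |r τ ω u i - Θstar u i| ≤
      √(2 * (η : ℝ) ^ 2 * Real.log (4 * (N * M) * ((τ : ℝ) + 1) ^ 2 / δ))}
      ≤ ENNReal.ofReal δ := by
  have hN' : (1 : ℝ) ≤ N := by exact_mod_cast hN
  have hM' : (1 : ℝ) ≤ M := by exact_mod_cast hM
  have htail : ∀ (τ : ℕ) (p : Fin N × Fin M), μ {ω | √(2 * (η : ℝ) ^ 2 *
      Real.log (4 * (N * M) * ((τ : ℝ) + 1) ^ 2 / δ)) < |r τ ω p.1 p.2 - Θstar p.1 p.2|}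
      ≤ ENNReal.ofReal (2 * (δ / (4 * (N * M) * ((τ : ℝ) + 1) ^ 2))) := fun τ p => by
    have h1 : 1 ≤ 4 * (N * M) * ((τ : ℝ) + 1) ^ 2 / δ := by
      rw [one_le_div hδ]
      have h2 : (1 : ℝ) ≤ N * M := one_le_mul_of_one_le_of_one_le hN' hM'
      have h3 : (1 : ℝ) ≤ ((τ : ℝ) + 1) ^ 2 := one_le_pow₀ (by linarith [τ.cast_nonneg (α := ℝ)])
      nlinarith [one_le_mul_of_one_le_of_one_le h2 h3]
    have h := measure_abs_gt_le (hr.subGaussian τ p.1 p.2) (Real.log_nonneg h1)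
    rwa [Real.exp_neg, Real.exp_log (by linarith), inv_div] at h
  calc _ ≤ μ (⋃ τ ∈ Finset.range T, ⋃ p ∈ (Finset.univ : Finset (Fin N × Fin M)),
        {ω | √(2 * (η : ℝ) ^ 2 * Real.log (4 * (N * M) * ((τ : ℝ) + 1) ^ 2 / δ))
          < |r τ ω p.1 p.2 - Θstar p.1 p.2|}) := by
        refine measure_mono fun ω hω => ?_
        simp only [Set.mem_ofPred_eq, not_forall, not_le] at hω
        obtain ⟨τ, hτ, u, i, hlt⟩ := hω
        exact Set.mem_biUnion (Finset.mem_range.2 hτ)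
          (Set.mem_biUnion (x := (u, i)) (Finset.mem_univ _) hlt)
    _ ≤ ∑ τ ∈ Finset.range T, ∑ _p : Fin N × Fin M,
          ENNReal.ofReal (2 * (δ / (4 * (N * M) * ((τ : ℝ) + 1) ^ 2))) :=
        (measure_biUnion_finset_le _ _).trans (Finset.sum_le_sum fun τ _ =>
          (measure_biUnion_finset_le _ _).trans (Finset.sum_le_sum fun p _ => htail τ p))
    _ = ENNReal.ofReal (δ / 2 * ∑ τ ∈ Finset.range T, 1 / ((τ : ℝ) + 1) ^ 2) := by
        rw [Finset.mul_sum, ENNReal.ofReal_sum_of_nonneg fun _ _ => by positivity]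
        refine Finset.sum_congr rfl fun τ _ => ?_
        rw [← ENNReal.ofReal_sum_of_nonneg fun _ _ => by positivity]
        congr 1
        simp only [Finset.sum_const, Finset.card_univ, Fintype.card_prod, Fintype.card_fin,
          nsmul_eq_mul]
        push_cast
        field_simp
        norm_num
    _ ≤ ENNReal.ofReal δ := by
        refine ENNReal.ofReal_le_ofReal ?_
        have := sum_inv_sq_le_two T
        nlinarith

theorem measure_not_goodNoise_le {N M T : ℕ} {Ω : Type*} [MeasurableSpace Ω] {μ : Measure Ω}
    [IsProbabilityMeasure μ] {η : ℝ≥0} {Θstar : Mat N M} {r : ℕ → Ω → Mat N M}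
    (hr : IsRewardModel μ η Θstar r) (hN : 0 < N) (hM : 0 < M) {π : Policy N M}
    (hπ : ∀ s, Measurable (π s)) {S : Finset (Mat N M)} (hS : 0 < S.card) {δ : ℝ} (hδ : 0 < δ)
    (hδ1 : δ ≤ 1) :
    μ {ω | ¬ GoodNoise π (fun s => r s ω) Θstar S η δ T} ≤ ENNReal.ofReal (2 * δ) := by
  calc _ ≤ _ := (measure_mono fun ω hω => not_and_or.1 hω).trans (measure_union_le _ _)
    _ ≤ ENNReal.ofReal δ + ENNReal.ofReal δ :=
        add_le_add (measure_cover_deviation_le hr hπ hS hδ)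
          (measure_large_noise_le hr hN hM hδ hδ1)
    _ = ENNReal.ofReal (2 * δ) := by
        rw [← ENNReal.ofReal_add hδ.le hδ.le]; congr 1; ring

/-! ### Optimism and the sum of the confidence widths -/

theorem frobInner_eq_sum {N M : ℕ} (A B : Mat N M) :
    frobInner A B = ∑ p : Fin N × Fin M, A p.1 p.2 * B p.1 p.2 := by
  rw [Fintype.sum_prod_type' fun u i => A u i * B u i, Finset.sum_comm]
  simp [frobInner, Matrix.trace, Matrix.mul_apply]

theorem frobInner_eq_sum_arms {N M : ℕ} {d : Fin N → ℝ} {c : Fin M → ℝ} {X : Mat N M}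
    (hX : X ∈ validAllocations d c) (Θ : Mat N M) :
    frobInner X Θ = ∑ p ∈ arms X, Θ p.1 p.2 := by
  rw [frobInner_eq_sum, arms, Finset.sum_filter]
  refine Finset.sum_congr rfl fun p _ => ?_
  rcases hX.1 p.1 p.2 with h | h <;> simp [h]

/-- The plays of a single pair contribute a harmonic sum: its `k`-th play has weight `1 / k`. -/
theorem sum_inv_count_le {T : ℕ} (hT : 0 < T) (a : ℕ → Prop) [DecidablePred a] :
    ∑ s ∈ Finset.range T, (if a s then
      1 / (((∑ σ ∈ Finset.range s, if a σ then 1 else 0 : ℕ) : ℝ) + 1) else 0)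
      ≤ 1 + Real.log T := by
  have h : ∀ T : ℕ, ∑ s ∈ Finset.range T, (if a s then
      1 / (((∑ σ ∈ Finset.range s, if a σ then 1 else 0 : ℕ) : ℝ) + 1) else 0)
      = ((harmonic (∑ σ ∈ Finset.range T, if a σ then 1 else 0) : ℚ) : ℝ) := fun T => by
    induction T with
    | zero => simp
    | succ T ih =>
      rw [Finset.sum_range_succ, ih, Finset.sum_range_succ _ T]
      split_ifs
      · rw [harmonic_succ, Rat.cast_add, Rat.cast_inv, Rat.cast_natCast, Nat.cast_succ, one_div]
      · simp
  rw [h]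
  refine (harmonic_le_one_add_log _).trans ?_
  have hle : (∑ σ ∈ Finset.range T, if a σ then 1 else 0) ≤ T := by
    calc _ ≤ ∑ _σ ∈ Finset.range T, 1 := Finset.sum_le_sum fun σ _ => by split_ifs <;> simp
      _ = T := by simp
  rcases Nat.eq_zero_or_pos (∑ σ ∈ Finset.range T, if a σ then 1 else 0) with h0 | hpos
  · rw [h0]
    have : 0 ≤ Real.log T := Real.log_nonneg (by exact_mod_cast hT)
    simpa using this
  · gcongr

theorem sum_sum_arms_inv_count_le {N M T : ℕ} (hT : 0 < T) (π : Policy N M) (r : ℕ → Mat N M) :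
    ∑ s ∈ Finset.range T, ∑ p ∈ arms (played π r s),
      1 / ((count (playedHistory π r s) p.1 p.2 : ℝ) + 1) ≤ N * M * (1 + Real.log T) := by
  have h1 : ∀ s, ∑ p ∈ arms (played π r s),
      1 / ((count (playedHistory π r s) p.1 p.2 : ℝ) + 1) =
      ∑ p : Fin N × Fin M, if p ∈ arms (played π r s) then
        1 / (((∑ σ ∈ Finset.range s, if p ∈ arms (played π r σ) then 1 else 0 : ℕ) : ℝ) + 1)
        else 0 := fun s => by
    rw [← Finset.sum_filter, Finset.filter_univ_mem]
    exact Finset.sum_congr rfl fun p _ => by rw [count_playedHistory]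
  simp_rw [h1]
  rw [Finset.sum_comm]
  calc _ ≤ ∑ _p : Fin N × Fin M, (1 + Real.log T) :=
        Finset.sum_le_sum fun p _ => sum_inv_count_le hT fun s => p ∈ arms (played π r s)
    _ = _ := by simp; ring

theorem betaStar_mono {N M : ℕ} (L : Set (Mat N M)) {η B G δ α γ : ℝ} (hN : 0 < N) (hM : 0 < M)
    (hδ : 0 < δ) (hα : 0 ≤ α) (hB : 0 ≤ B) {s t : ℕ} (hs : 0 < s) (hst : s ≤ t) :
    betaStar L η B G δ α γ s ≤ betaStar L η B G δ α γ t := by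
  have hN' : (0 : ℝ) < N := by exact_mod_cast hN
  have hM' : (0 : ℝ) < M := by exact_mod_cast hM
  have hs' : (0 : ℝ) < s := by exact_mod_cast hs
  have hst' : (s : ℝ) ≤ t := by exact_mod_cast hst
  unfold betaStar
  gcongr

/-- The regret of one round is at most the width of the confidence ellipsoid in the direction of
the allocation: by optimism the optimal value is at most the value of the played allocation for a
matrix of the confidence set, which is close to the mean matrix in the empirical norm. -/
theorem round_regret_le {N M s : ℕ} {d : Fin N → ℝ} {c : Fin M → ℝ} {L : Set (Mat N M)} {β : ℝ}
    {h : History N M s} {Θstar Θhat X Xopt : Mat N M} (hβ : 0 ≤ β) (hstar : Θstar ∈ L)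
    (hconf : ∑ u, ∑ i, ((count h u i : ℝ) + 1) * (Θstar - Θhat) u i ^ 2 ≤ β)
    (hopt : IsOptimistic (validAllocations d c) (confidenceSet L 1 β h Θhat) X)
    (hXopt : Xopt ∈ validAllocations d c) :
    frobInner Xopt Θstar - frobInner X Θstar ≤
      √(4 * β * ∑ p ∈ arms X, 1 / ((count h p.1 p.2 : ℝ) + 1)) := by
  obtain ⟨hX, Θ, ⟨-, hΘ⟩, hmax⟩ := hopt
  have hmem : Θstar ∈ confidenceSet L 1 β h Θhat := ⟨hstar, Real.sqrt_le_sqrt hconf⟩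
  have hΘ' : ∑ u, ∑ i, ((count h u i : ℝ) + 1) * (Θ - Θhat) u i ^ 2 ≤ β :=
    (Real.sqrt_le_sqrt_iff hβ).1 hΘ
  have hwidth : ∑ p ∈ arms X, ((count h p.1 p.2 : ℝ) + 1) * (Θ p.1 p.2 - Θstar p.1 p.2) ^ 2
      ≤ 4 * β := by
    calc ∑ p ∈ arms X, ((count h p.1 p.2 : ℝ) + 1) * (Θ p.1 p.2 - Θstar p.1 p.2) ^ 2
        ≤ ∑ p : Fin N × Fin M,
            ((count h p.1 p.2 : ℝ) + 1) * (Θ p.1 p.2 - Θstar p.1 p.2) ^ 2 :=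
          Finset.sum_le_sum_of_subset_of_nonneg (Finset.subset_univ _)
            fun _ _ _ => by positivity
      _ ≤ ∑ p : Fin N × Fin M, (2 * (((count h p.1 p.2 : ℝ) + 1) * (Θ - Θhat) p.1 p.2 ^ 2)
            + 2 * (((count h p.1 p.2 : ℝ) + 1) * (Θstar - Θhat) p.1 p.2 ^ 2)) := by
          refine Finset.sum_le_sum fun p _ => ?_
          simp only [Matrix.sub_apply]
          rw [← mul_left_comm, ← mul_left_comm (_ + 1) 2, ← mul_add]
          refine mul_le_mul_of_nonneg_left ?_ (by positivity)
          nlinarith [sq_nonneg (Θ p.1 p.2 + Θstar p.1 p.2 - 2 * Θhat p.1 p.2)]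
      _ = 2 * ∑ u, ∑ i, ((count h u i : ℝ) + 1) * (Θ - Θhat) u i ^ 2
            + 2 * ∑ u, ∑ i, ((count h u i : ℝ) + 1) * (Θstar - Θhat) u i ^ 2 := by
          rw [Finset.sum_add_distrib, ← Finset.mul_sum, ← Finset.mul_sum,
            ← Fintype.sum_prod_type', ← Fintype.sum_prod_type']
      _ ≤ 4 * β := by linarith
  have hle : frobInner Xopt Θstar - frobInner X Θstar
      ≤ ∑ p ∈ arms X, (Θ p.1 p.2 - Θstar p.1 p.2) := by
    have := hmax Xopt hXopt Θstar hmem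
    rw [frobInner_eq_sum_arms hX] at this ⊢
    rw [Finset.sum_sub_distrib]
    linarith
  refine hle.trans (Real.le_sqrt_of_sq_le ?_)
  have hcs := Finset.sum_mul_sq_le_sq_mul_sq (arms X)
    (fun p => √((count h p.1 p.2 : ℝ) + 1) * (Θ p.1 p.2 - Θstar p.1 p.2))
    (fun p => 1 / √((count h p.1 p.2 : ℝ) + 1))
  have e1 : ∀ p : Fin N × Fin M, √((count h p.1 p.2 : ℝ) + 1) * (Θ p.1 p.2 - Θstar p.1 p.2)
      * (1 / √((count h p.1 p.2 : ℝ) + 1)) = Θ p.1 p.2 - Θstar p.1 p.2 := fun p => by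
    have : √((count h p.1 p.2 : ℝ) + 1) ≠ 0 := by positivity
    field_simp
  have e2 : ∀ p : Fin N × Fin M, √((count h p.1 p.2 : ℝ) + 1) ^ 2 = (count h p.1 p.2 : ℝ) + 1 :=
    fun p => Real.sq_sqrt (by positivity)
  simp only [e1, mul_pow, div_pow, e2, one_pow] at hcs
  exact hcs.trans (mul_le_mul_of_nonneg_right hwidth
    (Finset.sum_nonneg fun _ _ => by positivity))

/-- The regret on good noise: Cauchy–Schwarz over the rounds reduces it to the harmonic sums of
the single pairs. -/
theorem regret_le_of_goodNoise {N M R T : ℕ} {B G η δ α : ℝ} {π : Policy N M} {r : ℕ → Mat N M}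
    {Θstar Θbar : Mat N M} {S : Finset (Mat N M)} {d : ℕ → Fin N → ℝ} {c : ℕ → Fin M → ℝ}
    {Xopt : ℕ → Mat N M}
    (hB : 0 ≤ B) (hα : 0 ≤ α) (hδ : 0 < δ) (hN : 0 < N) (hM : 0 < M) (hT : 0 < T)
    (hS : S.card = covNum (lowRankSet N M R B) α)
    (hSL : ∀ Θ ∈ S, Θ ∈ lowRankSet N M R B)
    (hcov : ∀ Θ ∈ lowRankSet N M R B, ∃ Θ' ∈ S, ‖Θ - Θ'‖ ≤ α)
    (hgood : GoodNoise π r Θstar S η δ T)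
    (hstar : Θstar ∈ lowRankSet N M R B) (hG : ‖Θbar - Θstar‖ ≤ G)
    (halg : FollowsAlgorithm T (fun s => validAllocations (d s) (c s)) (lowRankSet N M R B) Θbar
      η B G δ α 1 π)
    (hXopt : ∀ s < T, IsOptimalAllocation (validAllocations (d s) (c s)) Θstar (Xopt s)) :
    regret Θstar Xopt π r T ≤ √(T * (4 * betaStar (lowRankSet N M R B) η B G δ α 1 T *
      (N * M * (1 + Real.log T)))) := by
  set β := betaStar (lowRankSet N M R B) η B G δ α 1 T with hβ
  set V : ℕ → ℝ := fun s => ∑ p ∈ arms (played π r s),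
    1 / ((count (playedHistory π r s) p.1 p.2 : ℝ) + 1) with hV
  have hV0 : ∀ s, 0 ≤ V s := fun s => Finset.sum_nonneg fun _ _ => by positivity
  have hround : ∀ s ∈ Finset.range T,
      0 ≤ β ∧ frobInner (Xopt s) Θstar - frobInner (played π r s) Θstar ≤ √(4 * β * V s) := by
    intro s hs
    have hs' := Finset.mem_range.1 hs
    obtain ⟨Θhat, hls, hopt⟩ := halg s hs' (playedHistory π r s)
    have hconf := sum_count_mul_sq_le_betaStar hB hα hδ hN hM hS hSL hcov hgood hs' hstar hG hls
    have h0 : 0 ≤ betaStar (lowRankSet N M R B) η B G δ α 1 (s + 1) :=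
      le_trans (Finset.sum_nonneg fun _ _ => Finset.sum_nonneg fun _ _ => by positivity) hconf
    have hle : betaStar (lowRankSet N M R B) η B G δ α 1 (s + 1) ≤ β :=
      betaStar_mono _ hN hM hδ hα hB (Nat.succ_pos s) hs'
    refine ⟨h0.trans hle,
      (round_regret_le h0 hstar hconf hopt (hXopt s hs').1).trans (Real.sqrt_le_sqrt ?_)⟩
    have := hV0 s
    change _ * V s ≤ _
    gcongr
  have hβ0 : 0 ≤ β := (hround 0 (Finset.mem_range.2 hT)).1
  calc regret Θstar Xopt π r T ≤ ∑ s ∈ Finset.range T, √(4 * β * V s) :=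
        Finset.sum_le_sum fun s hs => (hround s hs).2
    _ ≤ √(T * ∑ s ∈ Finset.range T, 4 * β * V s) := by
        refine Real.le_sqrt_of_sq_le ?_
        refine (sq_sum_le_card_mul_sum_sq (s := Finset.range T)
          (f := fun s => √(4 * β * V s))).trans (le_of_eq ?_)
        rw [Finset.card_range]
        congr 1
        exact Finset.sum_congr rfl fun s _ => Real.sq_sqrt (by have := hV0 s; positivity)
    _ ≤ _ := by
        rw [← Finset.mul_sum]
        refine Real.sqrt_le_sqrt ?_
        have := sum_sum_arms_inv_count_le hT π r
        gcongr

/-! ### The order of the regret bound, and its expectation -/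

/-- The confidence parameter at the horizon divided by `R (N + M) log (1 + N M T)` is bounded by
a constant that depends only on `η`, `B` and `G`. -/
noncomputable def betaConst (η B G : ℝ) : ℝ :=
  8 * η ^ 2 * (Real.log (3 * (B + 2) ^ 2) / Real.log 2 + 6) + 80 * η ^ 2 + 32 * B + 4 + 8 * G ^ 2

theorem betaConst_nonneg {η B G : ℝ} (hB : 0 ≤ B) : 0 ≤ betaConst η B G := by
  have : 0 ≤ Real.log (3 * (B + 2) ^ 2) := Real.log_nonneg (by nlinarith)
  have : 0 ≤ Real.log 2 := Real.log_nonneg one_le_two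
  unfold betaConst
  positivity

theorem betaStar_le {N M T R : ℕ} {η B G : ℝ} (hN : 0 < N) (hM : 0 < M) (hT : 0 < T) (hR : 0 < R)
    (hB : 0 ≤ B) (hcov : 0 < covNum (lowRankSet N M R B) (1 / ((N : ℝ) * M * T))) :
    betaStar (lowRankSet N M R B) η B G (1 / ((N : ℝ) * M * T)) (1 / ((N : ℝ) * M * T)) 1 T ≤
      betaConst η B G * (((N : ℝ) + M) * R * Real.log (1 + (N : ℝ) * M * T)) := by
  have hN' : (1 : ℝ) ≤ N := by exact_mod_cast hN
  have hM' : (1 : ℝ) ≤ M := by exact_mod_cast hM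
  have hT' : (1 : ℝ) ≤ T := by exact_mod_cast hT
  have hR' : (1 : ℝ) ≤ R := by exact_mod_cast hR
  have hent := log_covNum_lowRankSet_le (R := R) hN hM hT hB
  have hNM : (1 : ℝ) ≤ N * M := one_le_mul_of_one_le_of_one_le hN' hM'
  set x : ℝ := (N : ℝ) * M * T with hx
  have hx1 : 1 ≤ x := one_le_mul_of_one_le_of_one_le hNM hT'
  set l := Real.log (1 + x) with hl
  set D : ℝ := ((N : ℝ) + M) * R with hD
  have hD1 : 1 ≤ D := one_le_mul_of_one_le_of_one_le (by linarith) hR'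
  set cB := Real.log (3 * (B + 2) ^ 2) / Real.log 2 with hcB
  have hl2 : 1 / 2 ≤ l := by
    have h1 : Real.log 2 ≤ l := Real.log_le_log (by norm_num) (by linarith)
    linarith [Real.log_two_gt_d9]
  have hDl : l ≤ D * l := le_mul_of_one_le_left (by linarith) hD1
  have hlogx : Real.log x ≤ l := Real.log_le_log (by linarith) (by linarith)
  have h1 : Real.log (covNum (lowRankSet N M R B) (1 / x) / (1 / x)) ≤ (cB + 6) * (D * l) := by
    have hc' : (0 : ℝ) < covNum (lowRankSet N M R B) (1 / x) := by exact_mod_cast hcov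
    rw [div_div_eq_mul_div, div_one, Real.log_mul hc'.ne' (by linarith)]
    have e : (cB + 5) * ((R : ℝ) * (N + M)) * l = (cB + 5) * (D * l) := by rw [hD]; ring
    linarith
  have h2 : √(8 * η ^ 2 * Real.log (4 * (N * M) * (T : ℝ) ^ 2 / (1 / x)))
      ≤ 1 + 40 * η ^ 2 * l := by
    have h3 : Real.log (4 * (N * M) * (T : ℝ) ^ 2 / (1 / x)) ≤ 5 * l := by
      have h4 : 4 * (N * M) * (T : ℝ) ^ 2 / (1 / x) ≤ (1 + x) ^ 5 := by
        have h5 : (N * M) * (T : ℝ) ^ 2 ≤ x ^ 2 := by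
          rw [hx, mul_pow]
          gcongr
          nlinarith
        calc 4 * (N * M) * (T : ℝ) ^ 2 / (1 / x) = 2 ^ 2 * ((N * M) * (T : ℝ) ^ 2) * x := by
              field_simp
              norm_num
          _ ≤ (1 + x) ^ 2 * (1 + x) ^ 2 * (1 + x) := by
              gcongr
              · linarith
              · exact h5.trans (by gcongr; linarith)
              · linarith
          _ = (1 + x) ^ 5 := by ring
      calc _ ≤ Real.log ((1 + x) ^ 5) := Real.log_le_log (by positivity) h4
        _ = 5 * l := by rw [Real.log_pow, hl]; norm_num
    refine Real.sqrt_le_iff.2 ⟨by positivity, ?_⟩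
    have h6 : 0 ≤ η ^ 2 * l := by positivity
    have h7 : 8 * η ^ 2 * Real.log (4 * (N * M) * (T : ℝ) ^ 2 / (1 / x)) ≤ 40 * (η ^ 2 * l) := by
      have := mul_le_mul_of_nonneg_left h3 (show 0 ≤ 8 * η ^ 2 by positivity)
      linarith
    nlinarith
  have h8 : 2 * (1 / x) * T * (N * M) = 2 := by
    rw [hx]; field_simp
  rw [betaStar, h8]
  have h9 := mul_le_mul_of_nonneg_left h1 (show 0 ≤ 8 * η ^ 2 by positivity)
  have h10 : 80 * η ^ 2 * l ≤ 80 * η ^ 2 * (D * l) :=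
    mul_le_mul_of_nonneg_left hDl (by positivity)
  have h11 : (32 * B + 4 + 8 * G ^ 2) * (1 / 2) ≤ (32 * B + 4 + 8 * G ^ 2) * (D * l) :=
    mul_le_mul_of_nonneg_left (hl2.trans hDl) (by positivity)
  rw [betaConst, ← hcB]
  linarith

/-- The constant in the regret bound. The summand `4 * B` pays for the failure event in
expectation. -/
noncomputable def regretConst (η B G : ℝ) : ℝ := √(12 * betaConst η B G) + 4 * B

theorem sqrt_regret_bound_le {N M T R : ℕ} {η B G : ℝ} (hN : 0 < N) (hM : 0 < M) (hT : 0 < T)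
    (hR : 0 < R) (hB : 0 ≤ B) (hcov : 0 < covNum (lowRankSet N M R B) (1 / ((N : ℝ) * M * T))) :
    √(T * (4 * betaStar (lowRankSet N M R B) η B G (1 / ((N : ℝ) * M * T))
      (1 / ((N : ℝ) * M * T)) 1 T * (N * M * (1 + Real.log T)))) ≤
    √(12 * betaConst η B G) * Real.log (1 + (N : ℝ) * M * T) *
      √((N : ℝ) * M * ((N : ℝ) + M) * R * T) := by
  have hβ := betaStar_le (η := η) (G := G) hN hM hT hR hB hcov
  have hN' : (1 : ℝ) ≤ N := by exact_mod_cast hN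
  have hM' : (1 : ℝ) ≤ M := by exact_mod_cast hM
  have hT' : (1 : ℝ) ≤ T := by exact_mod_cast hT
  have hNM : (1 : ℝ) ≤ N * M := one_le_mul_of_one_le_of_one_le hN' hM'
  have hTx : (T : ℝ) ≤ (N : ℝ) * M * T := le_mul_of_one_le_left (by linarith) hNM
  set l := Real.log (1 + (N : ℝ) * M * T) with hl
  have hl2 : 1 / 2 ≤ l := by
    have h1 : Real.log 2 ≤ l := Real.log_le_log (by norm_num) (by linarith)
    linarith [Real.log_two_gt_d9]
  have hlT : 1 + Real.log T ≤ 3 * l := by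
    have : Real.log T ≤ l := Real.log_le_log (by linarith) (by linarith)
    linarith
  have hlT0 : 0 ≤ Real.log T := Real.log_nonneg hT'
  have hc := betaConst_nonneg (η := η) (G := G) hB
  calc _ ≤ √(T * (4 * (betaConst η B G * (((N : ℝ) + M) * R * l)) * (N * M * (3 * l)))) := by
        gcongr
    _ = √(12 * betaConst η B G * l ^ 2 * ((N : ℝ) * M * ((N : ℝ) + M) * R * T)) := by
        congr 1; ring
    _ = _ := by
        rw [Real.sqrt_mul (by positivity), Real.sqrt_mul (by positivity),
          Real.sqrt_sq (by linarith)]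

theorem frobInner_mem_Icc {N M R : ℕ} {B : ℝ} {d : Fin N → ℝ} {c : Fin M → ℝ} {X Θ : Mat N M}
    (hX : X ∈ validAllocations d c) (hB : 0 ≤ B) (hΘ : Θ ∈ lowRankSet N M R B) :
    frobInner X Θ ∈ Set.Icc 0 ((N : ℝ) * M * B) := by
  rw [frobInner_eq_sum_arms hX]
  refine ⟨Finset.sum_nonneg fun p _ => (hΘ.2 p.1 p.2).1, ?_⟩
  calc ∑ p ∈ arms X, Θ p.1 p.2 ≤ ∑ _p ∈ arms X, B := Finset.sum_le_sum fun p _ => (hΘ.2 _ _).2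
    _ ≤ ∑ _p : Fin N × Fin M, B :=
        Finset.sum_le_sum_of_subset_of_nonneg (Finset.subset_univ _) fun _ _ _ => hB
    _ = _ := by simp

theorem regret_mem_Icc {N M R T : ℕ} {B : ℝ} {π : Policy N M} {r : ℕ → Mat N M}
    {Θstar : Mat N M} {d : ℕ → Fin N → ℝ} {c : ℕ → Fin M → ℝ} {Xopt : ℕ → Mat N M} (hB : 0 ≤ B)
    (hstar : Θstar ∈ lowRankSet N M R B)
    (hπ : ∀ s < T, played π r s ∈ validAllocations (d s) (c s))
    (hXopt : ∀ s < T, IsOptimalAllocation (validAllocations (d s) (c s)) Θstar (Xopt s)) :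
    regret Θstar Xopt π r T ∈ Set.Icc 0 ((N : ℝ) * M * T * B) := by
  constructor
  · exact Finset.sum_nonneg fun s hs => sub_nonneg.2
      ((hXopt s (Finset.mem_range.1 hs)).2 _ (hπ s (Finset.mem_range.1 hs)))
  · calc regret Θstar Xopt π r T ≤ ∑ _s ∈ Finset.range T, (N : ℝ) * M * B :=
          Finset.sum_le_sum fun s hs => by
            have hs' := Finset.mem_range.1 hs
            have h1 := (frobInner_mem_Icc (hXopt s hs').1 hB hstar).2
            have h2 := (frobInner_mem_Icc (hπ s hs') hB hstar).1
            linarith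
      _ = _ := by simp; ring

theorem measurable_regret {N M : ℕ} {Ω : Type*} [MeasurableSpace Ω] {π : Policy N M}
    (hπ : ∀ s, Measurable (π s)) {r : ℕ → Ω → Mat N M} (hr : ∀ s u i, Measurable fun ω => r s ω u i)
    (Θstar : Mat N M) (Xopt : ℕ → Mat N M) (T : ℕ) :
    Measurable fun ω => regret Θstar Xopt π (fun s => r s ω) T := by
  refine Finset.measurable_sum _ fun s _ => Measurable.const_sub ?_ _
  simp only [frobInner_eq_sum]
  refine Finset.measurable_sum _ fun p _ => Measurable.mul_const ?_ _
  exact (measurable_mat_entry p.1 p.2).comp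
    (measurable_played hπ (fun s => measurable_mat_of_entries (hr s)) s)

/-- A bound on a bounded random variable that holds with high probability turns into a bound on
its expectation. -/
theorem integral_le_of_measureReal_compl_le {Ω : Type*} [MeasurableSpace Ω] {μ : Measure Ω}
    [IsProbabilityMeasure μ] {X : Ω → ℝ} {b m q : ℝ} (hX : Measurable X) (hint : Integrable X μ)
    (hm : 0 ≤ m) (hb : 0 ≤ b) (hXm : ∀ ω, X ω ≤ m) (hq : μ.real {ω | X ω ≤ b}ᶜ ≤ q) :
    ∫ ω, X ω ∂μ ≤ b + m * q := by
  have hset : MeasurableSet {ω | X ω ≤ b}ᶜ := (measurableSet_le hX measurable_const).compl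
  have hind : Integrable ({ω | X ω ≤ b}ᶜ.indicator fun _ => m) μ :=
    (integrable_const m).indicator hset
  calc ∫ ω, X ω ∂μ ≤ ∫ ω, (b + {ω | X ω ≤ b}ᶜ.indicator (fun _ => m) ω) ∂μ := by
        refine integral_mono hint ((integrable_const b).add hind) fun ω => ?_
        by_cases h : X ω ≤ b
        · simp [Set.indicator, h]
        · simpa [Set.indicator, h] using (hXm ω).trans (by linarith)
    _ = b + m * μ.real {ω | X ω ≤ b}ᶜ := by
        rw [integral_add (integrable_const b) hind, integral_indicator_const m hset]
        simp [mul_comm]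
    _ ≤ b + m * q := by gcongr

/-- For `R = 0` the claimed bound is zero, and the mean matrix vanishes. -/
theorem regret_eq_zero_of_rank_zero {N M T : ℕ} {B : ℝ} {π : Policy N M} {r : ℕ → Mat N M}
    {Θstar : Mat N M} {Xopt : ℕ → Mat N M} (hstar : Θstar ∈ lowRankSet N M 0 B) :
    regret Θstar Xopt π r T = 0 := by
  have h0 : Θstar = 0 := by
    obtain ⟨A, W, h, -⟩ := exists_bounded_factorization Θstar hstar.1 (B := B) fun u i =>
      abs_le.2 ⟨by linarith [(hstar.2 u i).1, (hstar.2 u i).2], (hstar.2 u i).2⟩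
    rw [h]
    ext u i
    simp [Matrix.mul_apply]
  simp [regret, h0, frobInner]

end LRComb

theorem theorem2 :
    ∃ k : ℕ, ∀ (η : ℝ≥0) (B G : ℝ), ∃ C : ℝ,
      ∀ (N M R T : ℕ), 0 < N → 0 < M → 0 < T →
      -- `d s` and `c s` are the demands and capacities of round `s + 1`
      ∀ (d : ℕ → Fin N → ℝ) (c : ℕ → Fin M → ℝ) (Θstar Θbar : LRComb.Mat N M),
        Θstar ∈ LRComb.lowRankSet N M R B → ‖Θbar - Θstar‖ ≤ G →
      ∀ π : LRComb.Policy N M, (∀ s, Measurable (π s)) →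
        LRComb.FollowsAlgorithm T (fun s => LRComb.validAllocations (d s) (c s))
          (LRComb.lowRankSet N M R B) Θbar η B G
          (1 / ((N : ℝ) * M * T)) (1 / ((N : ℝ) * M * T)) 1 π →
      ∀ Xopt : ℕ → LRComb.Mat N M,
        (∀ s < T, LRComb.IsOptimalAllocation (LRComb.validAllocations (d s) (c s)) Θstar
          (Xopt s)) →
      ∀ (Ω : Type*) [MeasurableSpace Ω] (μ : Measure Ω) [IsProbabilityMeasure μ]
        (r : ℕ → Ω → LRComb.Mat N M), LRComb.IsRewardModel μ η Θstar r →
        1 - 2 / ((N : ℝ) * M * T) ≤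
          μ.real {ω | LRComb.regret Θstar Xopt π (fun s => r s ω) T ≤
            C * Real.log (1 + (N : ℝ) * M * T) ^ k *
              √((N : ℝ) * M * ((N : ℝ) + M) * R * T)} ∧
        Integrable (fun ω => LRComb.regret Θstar Xopt π (fun s => r s ω) T) μ ∧
        ∫ ω, LRComb.regret Θstar Xopt π (fun s => r s ω) T ∂μ ≤
          C * Real.log (1 + (N : ℝ) * M * T) ^ k *
            √((N : ℝ) * M * ((N : ℝ) + M) * R * T) := by
  refine ⟨1, fun η B G => ⟨LRComb.regretConst η B G, ?_⟩⟩
  intro N M R T hN hM hT d c Θstar Θbar hstar hG π hπ halg Xopt hXopt Ω _ μ _ r hr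
  have hB : 0 ≤ B := (hstar.2 ⟨0, hN⟩ ⟨0, hM⟩).1.trans (hstar.2 ⟨0, hN⟩ ⟨0, hM⟩).2
  have hN' : (1 : ℝ) ≤ N := by exact_mod_cast hN
  have hM' : (1 : ℝ) ≤ M := by exact_mod_cast hM
  have hT' : (1 : ℝ) ≤ T := by exact_mod_cast hT
  have hx1 : 1 ≤ (N : ℝ) * M * T :=
    one_le_mul_of_one_le_of_one_le (one_le_mul_of_one_le_of_one_le hN' hM') hT'
  rcases Nat.eq_zero_or_pos R with rfl | hR
  · simp only [LRComb.regret_eq_zero_of_rank_zero hstar]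
    have : 0 ≤ 2 / ((N : ℝ) * M * T) := by positivity
    simpa using this
  have hR' : (1 : ℝ) ≤ R := by exact_mod_cast hR
  have hδ : 0 < 1 / ((N : ℝ) * M * T) := by positivity
  have hδ1 : 1 / ((N : ℝ) * M * T) ≤ 1 := (div_le_one (by linarith)).2 hx1
  have hmeas := LRComb.measurable_regret hπ hr.measurable Θstar Xopt T
  have hrange : ∀ ω, LRComb.regret Θstar Xopt π (fun s => r s ω) T
      ∈ Set.Icc 0 ((N : ℝ) * M * T * B) := fun ω =>
    LRComb.regret_mem_Icc hB hstar (fun s hs => by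
      obtain ⟨_, _, hopt⟩ := halg s hs (LRComb.playedHistory π (fun s => r s ω) s)
      exact hopt.1) hXopt
  have hint : Integrable (fun ω => LRComb.regret Θstar Xopt π (fun s => r s ω) T) μ :=
    Integrable.of_mem_Icc _ _ hmeas.aemeasurable (Filter.Eventually.of_forall hrange)
  obtain ⟨S, hScard, hSpos, hSL, hcov⟩ :=
    LRComb.exists_cover_lowRankSet hN hM hB hδ ⟨Θstar, hstar⟩
  set l := Real.log (1 + (N : ℝ) * M * T) with hl
  have hl2 : 1 / 2 ≤ l := by
    have h1 : Real.log 2 ≤ l := Real.log_le_log (by norm_num) (by linarith)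
    linarith [Real.log_two_gt_d9]
  set W := √((N : ℝ) * M * ((N : ℝ) + M) * R * T) with hW
  have hW1 : 1 ≤ W := by
    refine Real.one_le_sqrt.2 ?_
    exact one_le_mul_of_one_le_of_one_le (one_le_mul_of_one_le_of_one_le
      (one_le_mul_of_one_le_of_one_le (one_le_mul_of_one_le_of_one_le hN' hM')
        (by linarith)) hR') hT'
  set b := √(12 * LRComb.betaConst η B G) * l * W with hb
  have hb0 : 0 ≤ b := by positivity
  have hbC : b + 2 * B ≤ LRComb.regretConst η B G * l ^ 1 * W := by
    have h1 : 1 / 2 ≤ l * W := by nlinarith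
    have h2 := mul_le_mul_of_nonneg_left h1 hB
    rw [LRComb.regretConst, hb, pow_one]
    linarith
  have hbad : μ.real {ω | LRComb.regret Θstar Xopt π (fun s => r s ω) T ≤ b}ᶜ
      ≤ 2 / ((N : ℝ) * M * T) := by
    refine ENNReal.toReal_le_of_le_ofReal (by positivity) ?_
    refine (measure_mono fun ω hω => ?_).trans ((LRComb.measure_not_goodNoise_le (T := T) hr hN hM
      hπ hSpos hδ hδ1).trans (le_of_eq (by rw [mul_one_div])))
    intro hgood
    refine hω ((LRComb.regret_le_of_goodNoise hB hδ.le hδ hN hM hT hScard hSL hcov hgood hstar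
      hG halg hXopt).trans ?_)
    exact LRComb.sqrt_regret_bound_le hN hM hT hR hB (hScard ▸ hSpos)
  have hexp := LRComb.integral_le_of_measureReal_compl_le hmeas hint (by positivity) hb0
    (fun ω => (hrange ω).2) hbad
  refine ⟨?_, hint, hexp.trans (le_trans (le_of_eq ?_) hbC)⟩
  · have hset : MeasurableSet {ω | LRComb.regret Θstar Xopt π (fun s => r s ω) T ≤ b} :=
      measurableSet_le hmeas measurable_const
    rw [probReal_compl_eq_one_sub hset] at hbad
    have hmono : μ.real {ω | LRComb.regret Θstar Xopt π (fun s => r s ω) T ≤ b} ≤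
        μ.real {ω | LRComb.regret Θstar Xopt π (fun s => r s ω) T ≤
          LRComb.regretConst η B G * l ^ 1 * W} :=
      measureReal_mono fun ω (h : _ ≤ b) => h.trans (by linarith)
    linarith
  · field_simp
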